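/- All rings are unital and associative but not necessarily commutative. For a ring $A$ and $S\subseteq A$, let $A\to A_S$ be the universal homomorphism to a ring making all elements of $S$ invertible. A ring homomorphism $\phi:A\to B$ is *local* if $\phi(a)\in B^\times$ implies $a\in A^\times$. A homomorphism $\phi:A\to B$ with $B\neq 0$ gives a *fully invertible system* $(S_1,S_2,\dots)$ on $A$: put $A_0=A$, $\phi_0=\phi$, and inductively let $S_{n+1}=\phi_n^{-1}(B^\times)\subseteq A_n$, $A_{n+1}=(A_n)_{S_{n+1}}$ and $\phi_{n+1}:A_{n+1}\to B$ be the extension of $\phi_n$. Let $\mathrm F(A)$ be the set of all fully invertible systems on $A$ (so $\mathrm F(0)=\emptyset$), and $A_{\mathcal S}=\varinjlim_n A_n$ for $\mathcal S\in\mathrm F(A)$. A *fraction* $\mathbf a=(a_1,\dots,a_n)$ of $A$ consists of $a_1\in A$, $a_2\in A_{a_1}$, $a_3\in (A_{a_1})_{a_2}$, and so on; $A_{\mathbf a}$ is the final localization. The topology of $\mathrm F(A)$ has as basis the sets $D(\mathbf a)$ of all $\mathcal S$ such that $a_1,\dots,a_n$ successively become invertible in $A_{\mathcal S}$ (equivalently,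 $A\to A_{\mathcal S}$ extends to $A_{\mathbf a}$). The sheaf $\mathcal O_A$ assigns to an open $U$ the ring of families $(t(\mathcal S)\in A_{\mathcal S})_{\mathcal S\in U}$ that are locally given by a single element of some $A_{\mathbf a}$. An *F-scheme* is a space with a sheaf of rings that is locally isomorphic, as a ringed space, to spaces $(\mathrm F(A),\mathcal O_A)$; a morphism of F-schemes is a morphism of ringed spaces inducing local homomorphisms on all stalks. A homomorphism $\chi:A\to B$ induces a morphism $\mathrm F(\chi):\mathrm F(B)\to\mathrm F(A)$, sending $\mathcal S$ to the system $\chi^*(\mathcal S)$ coming from $A\to B\to B_{\mathcal S}$, and a section $t$ to $\mathcal S\mapsto \chi^{\mathcal S}(t(\chi^*(\mathcal S)))$, where $\chi^{\mathcal S}:A_{\chi^*(\mathcal S)}\to B_{\mathcal S}$ is the natural homomorphism. **Theorem.** Let $f:X\to Y$ and $g:Z\to Y$ be morphisms of F-schemes. Then the fiber product $X\times_Y Z$ exists in the category of F-schemes (equivalently, the product of $X$ and $Z$ exists in the category of F-schemes over $Y$), and it is unique up to a unique isomorphism compatible with the projections. In the affine case $X=\mathrm F(A)$, $Z=\mathrm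 F(B)$, $Y=\mathrm F(R)$, the morphisms $f$ and $g$ are induced by unique ring homomorphisms $\alpha:R\to A$ and $\beta:R\to B$, and $\mathrm F(A*_R B)$, with the projections induced by the canonical homomorphisms $A\to A*_R B$ and $B\to A*_R B$, is a fiber product of $f$ and $g$; here $A*_R B$ is the coproduct of $A$ and $B$ over $R$ (the pushout of $\alpha$ and $\beta$ in the category of rings). In particular $\mathrm F(A)\times_{\mathrm F(R)}\mathrm F(B)\cong \mathrm F(A*_R B)$. -/

import Mathlib

universe u

open CategoryTheory TopologicalSpace Opposite

namespace FSchemes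

theorem hom_congr {A B : RingCat.{u}} {f g : A ⟶ B} (h : f = g) (a : A) : f a = g a := by rw [h]

/-! ### Universal localization of a (not necessarily commutative) ring at a subset -/

/-- The relations of `A_S = ⟨A, {x_s} | x_s s = s x_s = 1⟩` on the free ring on the generators
`a` (`a ∈ A`, in the form `Sum.inl a`) and `x_s` (`s ∈ S`, in the form `Sum.inr s`); the first
three relations say that the generators `a` are added and multiplied as in `A`. -/
inductive LocRel (A : RingCat.{u}) (S : Set A) :
    FreeAlgebra ℤ (A ⊕ S) → FreeAlgebra ℤ (A ⊕ S) → Prop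
  | one : LocRel A S (FreeAlgebra.ι ℤ (Sum.inl 1)) 1
  | add (a b : A) : LocRel A S (FreeAlgebra.ι ℤ (Sum.inl (a + b)))
      (FreeAlgebra.ι ℤ (Sum.inl a) + FreeAlgebra.ι ℤ (Sum.inl b))
  | mul (a b : A) : LocRel A S (FreeAlgebra.ι ℤ (Sum.inl (a * b)))
      (FreeAlgebra.ι ℤ (Sum.inl a) * FreeAlgebra.ι ℤ (Sum.inl b))
  | inv_mul (s : S) : LocRel A S
      (FreeAlgebra.ι ℤ (Sum.inr s) * FreeAlgebra.ι ℤ (Sum.inl s.1)) 1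
  | mul_inv (s : S) : LocRel A S
      (FreeAlgebra.ι ℤ (Sum.inl s.1) * FreeAlgebra.ι ℤ (Sum.inr s)) 1

/-- The localization `A_S`: the universal ring under `A` in which the elements of `S` become
invertible. -/
def Loc (A : RingCat.{u}) (S : Set A) : RingCat.{u} := RingCat.of (RingQuot (LocRel A S))

namespace Loc

variable {A B : RingCat.{u}} {S : Set A}

/-- The class in `A_S` of an element of the free ring. -/
def mk (A : RingCat.{u}) (S : Set A) : FreeAlgebra ℤ (A ⊕ S) →+* Loc A S :=
  RingQuot.mkRingHom (LocRel A S)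

theorem mk_rel {x y : FreeAlgebra ℤ (A ⊕ S)} (h : LocRel A S x y) : mk A S x = mk A S y :=
  RingQuot.mkRingHom_rel h

/-- The canonical homomorphism `i_S : A → A_S`. -/
def ι (A : RingCat.{u}) (S : Set A) : A ⟶ Loc A S :=
  RingCat.ofHom (RingHom.mk'
    ({ toFun := fun a => mk A S (FreeAlgebra.ι ℤ (Sum.inl a))
       map_one' := by rw [mk_rel .one, map_one]
       map_mul' := fun a b => by rw [mk_rel (.mul a b), map_mul] } : A →* Loc A S)
    (fun a b => by
      change mk A S _ = mk A S _ + mk A S _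
      rw [mk_rel (.add a b), map_add]))

theorem ι_apply (a : A) : ι A S a = mk A S (FreeAlgebra.ι ℤ (Sum.inl a)) := rfl

theorem isUnit_ι {s : A} (hs : s ∈ S) : IsUnit (ι A S s) :=
  isUnit_iff_exists.2 ⟨mk A S (FreeAlgebra.ι ℤ (Sum.inr ⟨s, hs⟩)),
    by rw [ι_apply, ← map_mul, mk_rel (.mul_inv ⟨s, hs⟩), map_one],
    by rw [ι_apply, ← map_mul, mk_rel (.inv_mul ⟨s, hs⟩), map_one]⟩

/-- The map on generators used to define `Loc.lift`. -/
noncomputable def liftFun (φ : A ⟶ B) (h : ∀ s ∈ S, IsUnit (φ s)) : A ⊕ S → B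
  | Sum.inl a => φ a
  | Sum.inr s => ((h s.1 s.2).unit⁻¹ : Bˣ)

/-- The homomorphism `φ_S : A_S → B` given by the universal property of `A_S`. -/
noncomputable def lift (φ : A ⟶ B) (h : ∀ s ∈ S, IsUnit (φ s)) : Loc A S ⟶ B :=
  RingCat.ofHom (RingQuot.lift ⟨(FreeAlgebra.lift ℤ (liftFun φ h)).toRingHom, by
    intro x y r
    cases r with
    | one => simp [liftFun]
    | add a b => simp [liftFun]
    | mul a b => simp [liftFun]
    | inv_mul s => simp [liftFun]
    | mul_inv s => simp [liftFun]⟩)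

@[simp]
theorem ι_lift (φ : A ⟶ B) (h : ∀ s ∈ S, IsUnit (φ s)) : ι A S ≫ lift φ h = φ := by
  ext a
  refine (RingQuot.lift_mkRingHom_apply (FreeAlgebra.lift ℤ (liftFun φ h)).toRingHom _ _).trans ?_
  simp [liftFun]

theorem hom_ext {f g : Loc A S ⟶ B} (h : ι A S ≫ f = ι A S ≫ g) : f = g := by
  have hl : ∀ a : A, f (ι A S a) = g (ι A S a) := fun a => hom_congr h a
  apply RingCat.hom_ext
  apply RingQuot.ringQuot_ext
  have key : ((f.hom.comp (mk A S)).toIntAlgHom : FreeAlgebra ℤ (A ⊕ S) →ₐ[ℤ] B) =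
      (g.hom.comp (mk A S)).toIntAlgHom := by
    apply FreeAlgebra.hom_ext
    funext x
    change f (mk A S (FreeAlgebra.ι ℤ x)) = g (mk A S (FreeAlgebra.ι ℤ x))
    cases x with
    | inl a => exact hl a
    | inr s =>
      have e1 : mk A S (FreeAlgebra.ι ℤ (Sum.inr s)) * ι A S s.1 = 1 := by
        rw [ι_apply, ← map_mul, mk_rel (.inv_mul s), map_one]
      have e2 : ι A S s.1 * mk A S (FreeAlgebra.ι ℤ (Sum.inr s)) = 1 := by
        rw [ι_apply, ← map_mul, mk_rel (.mul_inv s), map_one]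
      change f (mk A S (FreeAlgebra.ι ℤ (Sum.inr s))) = g (mk A S (FreeAlgebra.ι ℤ (Sum.inr s)))
      refine left_inv_eq_right_inv (a := f (ι A S s.1)) ?_ ?_
      · rw [← map_mul, e1, map_one]
      · rw [hl, ← map_mul, e2, map_one]
  ext x
  exact DFunLike.congr_fun key x

end Loc

/-! ### Fully invertible systems -/

/-- A small family of rings. -/
structure Level where
  idx : Type u
  ring : idx → RingCat.{u}

/-- `sysLevel A n` consists of all `(S_1, …, S_n)` with `S_{i+1}` a subset of the ring `A_i`,
where `A_0 = A` and `A_{i+1} = (A_i)_{S_{i+1}}`; the ring attached to `(S_1, …, S_n)` is `A_n`. -/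
def sysLevel (A : RingCat.{u}) : ℕ → Level.{u}
  | 0 => ⟨PUnit, fun _ => A⟩
  | n + 1 => ⟨Σ x : (sysLevel A n).idx, Set ((sysLevel A n).ring x), fun y => Loc _ y.2⟩

/-- The first `n` sets `(S_1, …, S_n)` of the fully invertible system coming from `φ : A → B`,
together with the homomorphism `φ_n : A_n → B`; recursively `S_{n+1}` is the set of elements of
`A_n` whose image under `φ_n` is invertible. -/
noncomputable def sysOf {A B : RingCat.{u}} (φ : A ⟶ B) :
    (n : ℕ) → Σ x : (sysLevel A n).idx, ((sysLevel A n).ring x ⟶ B)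
  | 0 => ⟨PUnit.unit, φ⟩
  | n + 1 => ⟨⟨(sysOf φ n).1, {a | IsUnit ((sysOf φ n).2 a)}⟩,
      Loc.lift (sysOf φ n).2 (fun _ hs => hs)⟩

/-- The set `F(A)` of fully invertible systems on `A`: the sequences `(S_1, S_2, …)`, given
through their initial segments `(S_1, …, S_n)`, that come from a homomorphism to a nonzero ring. -/
def FullSpec (A : RingCat.{u}) : Type u :=
  {s : ∀ n, (sysLevel A n).idx //
    ∃ (B : RingCat.{u}) (φ : A ⟶ B), Nontrivial B ∧ s = fun n => (sysOf φ n).1}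

namespace FullSpec

variable {A B : RingCat.{u}}

/-- The fully invertible system coming from `φ`. -/
noncomputable def ofHom (φ : A ⟶ B) (hB : Nontrivial B) : FullSpec A :=
  ⟨fun n => (sysOf φ n).1, B, φ, hB, rfl⟩

theorem succ_fst (s : FullSpec A) (n : ℕ) : (s.1 (n + 1)).1 = s.1 n := by
  obtain ⟨s, B, φ, hB, rfl⟩ := s
  rfl

/-- The ring `A_{S,n}`. -/
def stage (s : FullSpec A) (n : ℕ) : RingCat.{u} := (sysLevel A n).ring (s.1 n)

/-- The canonical homomorphism `A_{S,n} → A_{S,n+1} = (A_{S,n})_{S_{n+1}}`. -/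
def stageMap (s : FullSpec A) (n : ℕ) : s.stage n ⟶ s.stage (n + 1) :=
  eqToHom (congrArg (sysLevel A n).ring (s.succ_fst n).symm) ≫ Loc.ι _ (s.1 (n + 1)).2

/-- The localization `A_S` of `A` at a fully invertible system: the direct limit of the rings
`A_{S,n}`. -/
noncomputable def loc (s : FullSpec A) : RingCat.{u} :=
  Limits.colimit (Functor.ofSequence s.stageMap)

/-- The canonical homomorphism `A_{S,n} → A_S`. -/
noncomputable def ofStage (s : FullSpec A) (n : ℕ) : s.stage n ⟶ s.loc :=
  Limits.colimit.ι (Functor.ofSequence s.stageMap) n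

/-- The canonical homomorphism `i_S : A → A_S`. -/
noncomputable def toLoc (s : FullSpec A) : A ⟶ s.loc := s.ofStage 0

theorem stageMap_ofStage (s : FullSpec A) (n : ℕ) :
    s.stageMap n ≫ s.ofStage (n + 1) = s.ofStage n := by
  have := Limits.colimit.w (Functor.ofSequence s.stageMap) (homOfLE (Nat.le_add_right n 1))
  rwa [Functor.ofSequence_map_homOfLE_succ] at this

theorem exists_ofStage (s : FullSpec A) (x : s.loc) : ∃ (n : ℕ) (y : s.stage n),
    s.ofStage n y = x :=
  haveI : Limits.PreservesFilteredColimitsOfSize.{0, 0} (forget RingCat.{u}) :=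
    Limits.preservesSmallestFilteredColimits_of_preservesFilteredColimits _
  Limits.Concrete.colimit_exists_rep (Functor.ofSequence s.stageMap) x

theorem stageMap_ofHom (φ : A ⟶ B) (hB : Nontrivial B) (n : ℕ) :
    (ofHom φ hB).stageMap n = Loc.ι _ {a | IsUnit ((sysOf φ n).2 a)} :=
  Category.id_comp _

/-- The homomorphism `A_S → B` extending `φ : A → B` when `S` is the system coming from `φ`. -/
noncomputable def desc (φ : A ⟶ B) (hB : Nontrivial B) : (ofHom φ hB).loc ⟶ B :=
  Limits.colimit.desc (Functor.ofSequence (ofHom φ hB).stageMap)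
    ⟨B, NatTrans.ofSequence (fun n => (sysOf φ n).2) (fun n => by
      rw [Functor.ofSequence_map_homOfLE_succ, stageMap_ofHom]
      exact (Loc.ι_lift _ _).trans (Category.comp_id _).symm)⟩

theorem ofStage_desc (φ : A ⟶ B) (hB : Nontrivial B) (n : ℕ) :
    (ofHom φ hB).ofStage n ≫ desc φ hB = (sysOf φ n).2 :=
  Limits.colimit.ι_desc _ _

theorem toLoc_desc (φ : A ⟶ B) (hB : Nontrivial B) : (ofHom φ hB).toLoc ≫ desc φ hB = φ :=
  ofStage_desc φ hB 0

theorem isLocalHom_desc (φ : A ⟶ B) (hB : Nontrivial B) : IsLocalHom (desc φ hB).hom := by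
  refine ⟨fun x hx => ?_⟩
  obtain ⟨n, y, rfl⟩ := exists_ofStage _ x
  have hy : IsUnit ((sysOf φ n).2 y) := by
    rw [← ofStage_desc φ hB n]
    exact hx
  rw [← stageMap_ofStage, stageMap_ofHom]
  exact (Loc.isUnit_ι (S := {a | IsUnit ((sysOf φ n).2 a)}) hy).map
    ((ofHom φ hB).ofStage (n + 1)).hom

theorem nontrivial_loc (s : FullSpec A) : Nontrivial s.loc := by
  obtain ⟨s, B, φ, hB, rfl⟩ := s
  exact (desc φ hB).hom.domain_nontrivial

end FullSpec

/-! ### Fractions -/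

/-- `fracLevel A n` consists of all fractions `(a_1, …, a_n)` with `a_{i+1} ∈ A_i`, where
`A_0 = A` and `A_{i+1} = (A_i)_{a_{i+1}}`; the ring attached to `(a_1, …, a_n)` is `A_n`. -/
def fracLevel (A : RingCat.{u}) : ℕ → Level.{u}
  | 0 => ⟨PUnit, fun _ => A⟩
  | n + 1 => ⟨Σ x : (fracLevel A n).idx, (fracLevel A n).ring x, fun y => Loc _ {y.2}⟩

/-- `Extends φ n a h`: the entries of the fraction `a = (a_1, …, a_n)` successively become
invertible in `B` under `φ : A → B`, and `h : A_a → B` is the resulting extension of `φ`. -/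
def Extends {A B : RingCat.{u}} (φ : A ⟶ B) :
    (n : ℕ) → (a : (fracLevel A n).idx) → ((fracLevel A n).ring a ⟶ B) → Prop
  | 0, _, h => h = φ
  | n + 1, a, h => ∃ g : (fracLevel A n).ring a.1 ⟶ B,
      Extends φ n a.1 g ∧ IsUnit (g a.2) ∧ Loc.ι _ {a.2} ≫ h = g

section Extends

variable {A B C : RingCat.{u}}

theorem Extends.unique {φ : A ⟶ B} : ∀ {n : ℕ} {a : (fracLevel A n).idx}
    {h h' : (fracLevel A n).ring a ⟶ B}, Extends φ n a h → Extends φ n a h' → h = h'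
  | 0, _, _, _, e, e' => e.trans e'.symm
  | _ + 1, _, _, _, ⟨_, e, _, w⟩, ⟨_, e', _, w'⟩ =>
    Loc.hom_ext (w.trans ((e.unique e').trans w'.symm))

theorem Extends.comp {φ : A ⟶ B} (ψ : B ⟶ C) : ∀ {n : ℕ} {a : (fracLevel A n).idx}
    {h : (fracLevel A n).ring a ⟶ B}, Extends φ n a h → Extends (φ ≫ ψ) n a (h ≫ ψ)
  | 0, _, _, e => congrArg (fun k => k ≫ ψ) e
  | _ + 1, _, h, ⟨g, e, hu, w⟩ => ⟨g ≫ ψ, e.comp ψ, hu.map ψ.hom, by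
      rw [← w]; exact (Category.assoc _ _ _).symm⟩

theorem Extends.succ {φ : A ⟶ B} {n : ℕ} {a : (fracLevel A n).idx}
    {g : (fracLevel A n).ring a ⟶ B} (e : Extends φ n a g) (b : (fracLevel A n).ring a)
    (hb : IsUnit (g b)) : ∃ h : Loc _ {b} ⟶ B, Extends φ (n + 1) ⟨a, b⟩ h ∧ Loc.ι _ {b} ≫ h = g :=
  ⟨Loc.lift g (by rintro _ rfl; exact hb), ⟨g, e, hb, Loc.ι_lift _ _⟩, Loc.ι_lift _ _⟩

/-- An extension over a local homomorphism descends. -/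
theorem Extends.descend {φ : A ⟶ B} (ψ : B ⟶ C) (hψ : IsLocalHom ψ.hom) :
    ∀ {n : ℕ} {a : (fracLevel A n).idx} {h : (fracLevel A n).ring a ⟶ C},
      Extends (φ ≫ ψ) n a h → ∃ k, Extends φ n a k
  | 0, _, _, _ => ⟨φ, rfl⟩
  | _ + 1, a, _, ⟨g, e, hu, _⟩ => by
    obtain ⟨k, hk⟩ := e.descend ψ hψ
    have hg : g = k ≫ ψ := e.unique (hk.comp ψ)
    obtain ⟨k', hk', -⟩ := hk.succ a.2 (hψ.map_nonunit _ (by rw [hg] at hu; exact hu))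
    exact ⟨k', hk'⟩

/-- Two fractions have a common refinement. -/
theorem exists_refinement {m : ℕ} (a : (fracLevel A m).idx) :
    ∀ {n : ℕ} (b : (fracLevel A n).idx), ∃ (k : ℕ) (c : (fracLevel A k).idx)
      (f : (fracLevel A m).ring a ⟶ (fracLevel A k).ring c)
      (g : (fracLevel A n).ring b ⟶ (fracLevel A k).ring c),
      ∀ {B : RingCat.{u}} {φ : A ⟶ B} {h h'}, Extends φ m a h → Extends φ n b h' →
        ∃ l, Extends φ k c l ∧ f ≫ l = h ∧ g ≫ l = h' := by
  intro n
  induction n with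
  | zero =>
    intro b
    have : ∃ i : A ⟶ (fracLevel A m).ring a, ∀ {B : RingCat.{u}} {φ : A ⟶ B} {h},
        Extends φ m a h → i ≫ h = φ := by
      clear b
      induction m with
      | zero => exact ⟨𝟙 A, fun e => (Category.id_comp _).trans e⟩
      | succ m ih =>
        obtain ⟨i, hi⟩ := ih a.1
        refine ⟨i ≫ Loc.ι _ {a.2}, ?_⟩
        rintro B φ h ⟨g, e, -, w⟩
        have := hi e
        rw [← w] at this
        exact (Category.assoc _ _ _).trans this
    obtain ⟨i, hi⟩ := this
    exact ⟨m, a, 𝟙 _, i, fun {B φ h h'} e e' =>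
      ⟨h, e, Category.id_comp _, (hi e).trans (Eq.symm e')⟩⟩
  | succ n ih =>
    intro b
    obtain ⟨k, c, f, g, H⟩ := ih b.1
    refine ⟨k + 1, ⟨c, g b.2⟩, f ≫ Loc.ι _ {g b.2},
      Loc.lift (g ≫ Loc.ι _ {g b.2}) (by
        rintro _ rfl; exact Loc.isUnit_ι (Set.mem_singleton _)), ?_⟩
    rintro B φ h h' e ⟨h'', e', hu, w⟩
    obtain ⟨l, hl, h1, h2⟩ := H e e'
    obtain ⟨l', hl', w'⟩ := hl.succ (g b.2) (by rw [← h2] at hu; exact hu)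
    refine ⟨l', hl', ?_, ?_⟩
    · rw [← h1, ← w']; exact Category.assoc _ _ _
    · apply Loc.hom_ext
      refine (Category.assoc _ _ _).symm.trans
        ((congrArg (fun q => q ≫ l') (Loc.ι_lift _ _)).trans ?_)
      rw [w, ← h2, ← w']
      exact Category.assoc _ _ _

/-- The image `χ(a) = (χ(a_1), χ_1(a_2), …)` of a fraction `a` under `χ : A → A'`, with the
induced homomorphism `A_a → A'_{χ(a)}`. -/
noncomputable def pushFrac (χ : A ⟶ B) : (n : ℕ) → (a : (fracLevel A n).idx) →
    Σ b : (fracLevel B n).idx, ((fracLevel A n).ring a ⟶ (fracLevel B n).ring b)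
  | 0, _ => ⟨PUnit.unit, χ⟩
  | n + 1, a => ⟨⟨(pushFrac χ n a.1).1, (pushFrac χ n a.1).2 a.2⟩,
      Loc.lift ((pushFrac χ n a.1).2 ≫ Loc.ι _ {(pushFrac χ n a.1).2 a.2}) (by
        rintro _ rfl; exact Loc.isUnit_ι (Set.mem_singleton _))⟩

theorem Extends.of_push (χ : A ⟶ B) {φ : B ⟶ C} : ∀ {n : ℕ} {a : (fracLevel A n).idx} {h},
    Extends φ n (pushFrac χ n a).1 h → Extends (χ ≫ φ) n a ((pushFrac χ n a).2 ≫ h)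
  | 0, _, _, e => congrArg (fun k => χ ≫ k) e
  | n + 1, a, h, ⟨g, e, hu, w⟩ => by
    refine ⟨_, e.of_push χ, hu, ?_⟩
    rw [← w]
    exact (Category.assoc _ _ _).symm.trans
      ((congrArg (fun k => k ≫ h) (Loc.ι_lift _ _)).trans (Category.assoc _ _ _))

theorem Extends.push (χ : A ⟶ B) {φ : B ⟶ C} : ∀ {n : ℕ} {a : (fracLevel A n).idx} {h},
    Extends (χ ≫ φ) n a h → ∃ k, Extends φ n (pushFrac χ n a).1 k
  | 0, _, _, _ => ⟨φ, rfl⟩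
  | n + 1, a, h, ⟨g, e, hu, w⟩ => by
    obtain ⟨k, hk⟩ := e.push χ
    have hg : g = _ ≫ k := e.unique (hk.of_push χ)
    obtain ⟨l, hl, -⟩ := hk.succ ((pushFrac χ n a.1).2 a.2) (by rw [hg] at hu; exact hu)
    exact ⟨l, hl⟩

end Extends

/-! ### The full spectrum as a topological space -/

namespace FullSpec

variable {A B : RingCat.{u}}

/-- The fundamental open set `D(a)`: the fully invertible systems `S` such that the entries of
the fraction `a` successively become invertible in `A_S`. -/
def basicOpen {n : ℕ} (a : (fracLevel A n).idx) : Set (FullSpec A) :=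
  {s | ∃ h, Extends s.toLoc n a h}

/-- The topology on `F(A)` generated by the fundamental open sets. -/
instance : TopologicalSpace (FullSpec A) :=
  generateFrom {U | ∃ (n : ℕ) (a : (fracLevel A n).idx), U = basicOpen a}

theorem isOpen_basicOpen {n : ℕ} (a : (fracLevel A n).idx) : IsOpen (basicOpen a) :=
  isOpen_generateFrom_of_mem ⟨n, a, rfl⟩

/-- The pull back `χ^*(S)` of a fully invertible system `S` on `B` along `χ : A → B`: the system
coming from the composition `A → B → B_S`. -/
noncomputable def pullback (χ : A ⟶ B) (s : FullSpec B) : FullSpec A :=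
  ofHom (χ ≫ s.toLoc) s.nontrivial_loc

/-- The local homomorphism `χ^S : A_{χ^*(S)} → B_S`. -/
noncomputable def pullbackLoc (χ : A ⟶ B) (s : FullSpec B) : (pullback χ s).loc ⟶ s.loc :=
  desc (χ ≫ s.toLoc) s.nontrivial_loc

theorem toLoc_pullbackLoc (χ : A ⟶ B) (s : FullSpec B) :
    (pullback χ s).toLoc ≫ pullbackLoc χ s = χ ≫ s.toLoc :=
  toLoc_desc _ _

theorem isLocalHom_pullbackLoc (χ : A ⟶ B) (s : FullSpec B) :
    IsLocalHom (pullbackLoc χ s).hom :=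
  isLocalHom_desc _ _

theorem extends_pullback (χ : A ⟶ B) (s : FullSpec B) {n : ℕ} {a : (fracLevel A n).idx} {k h}
    (hk : Extends s.toLoc n (pushFrac χ n a).1 k) (hh : Extends (pullback χ s).toLoc n a h) :
    h ≫ pullbackLoc χ s = (pushFrac χ n a).2 ≫ k := by
  have h1 := hh.comp (pullbackLoc χ s)
  rw [toLoc_pullbackLoc] at h1
  exact h1.unique (hk.of_push χ)

theorem preimage_basicOpen (χ : A ⟶ B) {n : ℕ} (a : (fracLevel A n).idx) :
    pullback χ ⁻¹' basicOpen a = basicOpen (pushFrac χ n a).1 := by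
  ext s
  constructor
  · rintro ⟨h, hh⟩
    have h1 := hh.comp (pullbackLoc χ s)
    rw [toLoc_pullbackLoc] at h1
    exact h1.push χ
  · rintro ⟨h, hh⟩
    have h1 := hh.of_push χ
    rw [← toLoc_pullbackLoc] at h1
    exact h1.descend _ (isLocalHom_pullbackLoc χ s)

theorem continuous_pullback (χ : A ⟶ B) : Continuous (pullback χ) := by
  refine continuous_generateFrom_iff.2 ?_
  rintro _ ⟨n, a, rfl⟩
  rw [preimage_basicOpen]
  exact isOpen_basicOpen _

/-- `F(A)` as an object of the category of topological spaces. -/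
def top (A : RingCat.{u}) : TopCat.{u} := TopCat.of (FullSpec A)

/-- The continuous map `F(B) → F(A)`, `S ↦ χ^*(S)`. -/
noncomputable def topMap (χ : A ⟶ B) : top B ⟶ top A :=
  TopCat.ofHom ⟨pullback χ, continuous_pullback χ⟩

/-! ### The structure sheaf -/

/-- Families of elements `t(S) ∈ A_S`, `S ∈ U`, which are given by a single element `b ∈ A_a` for
some fraction `a` belonging to every `S ∈ U`. -/
def isFraction (A : RingCat.{u}) :
    TopCat.PrelocalPredicate (X := top A) (fun s : FullSpec A => s.loc) where
  pred {U} t := ∃ (n : ℕ) (a : (fracLevel A n).idx) (b : (fracLevel A n).ring a),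
    ∀ s : U, ∃ h, Extends (toLoc s.1) n a h ∧ t s = h b
  res := by
    rintro V U i t ⟨n, a, b, H⟩
    exact ⟨n, a, b, fun s => H (i s)⟩

/-- Families of elements `t(S) ∈ A_S`, `S ∈ U`, which are locally given by fractions. -/
def isLocallyFraction (A : RingCat.{u}) :
    TopCat.LocalPredicate (X := top A) (fun s : FullSpec A => s.loc) :=
  (isFraction A).sheafify

/-- The ring `O_A(U)`. -/
def sections (A : RingCat.{u}) (U : Opens (top A)) :
    Subring (∀ s : U, FullSpec.loc (A := A) s.1) where
  carrier := {t | (isLocallyFraction A).pred t}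
  zero_mem' s := ⟨U, s.2, 𝟙 _, 0, PUnit.unit, (0 : A), fun x => ⟨toLoc x.1, rfl, (map_zero _).symm⟩⟩
  one_mem' s := ⟨U, s.2, 𝟙 _, 0, PUnit.unit, (1 : A), fun x => ⟨toLoc x.1, rfl, (map_one _).symm⟩⟩
  neg_mem' {t} ht s := by
    obtain ⟨V, hV, i, n, a, b, H⟩ := ht s
    refine ⟨V, hV, i, n, a, -b, fun x => ?_⟩
    obtain ⟨h, e, hb⟩ := H x
    exact ⟨h, e, (congrArg Neg.neg hb).trans (map_neg h.hom b).symm⟩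
  add_mem' {t t'} ht ht' s := by
    obtain ⟨V, hV, i, n, a, b, H⟩ := ht s
    obtain ⟨V', hV', i', n', a', b', H'⟩ := ht' s
    obtain ⟨k, c, f, g, R⟩ := exists_refinement a a'
    refine ⟨V ⊓ V', ⟨hV, hV'⟩, Opens.infLELeft _ _ ≫ i, k, c, f b + g b', fun x => ?_⟩
    obtain ⟨h, e, hb⟩ := H ⟨x.1, x.2.1⟩
    obtain ⟨h', e', hb'⟩ := H' ⟨x.1, x.2.2⟩
    obtain ⟨l, hl, rfl, rfl⟩ := R e e'
    exact ⟨l, hl, (congrArg₂ (· + ·) hb hb').trans (map_add l.hom (f b) (g b')).symm⟩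
  mul_mem' {t t'} ht ht' s := by
    obtain ⟨V, hV, i, n, a, b, H⟩ := ht s
    obtain ⟨V', hV', i', n', a', b', H'⟩ := ht' s
    obtain ⟨k, c, f, g, R⟩ := exists_refinement a a'
    refine ⟨V ⊓ V', ⟨hV, hV'⟩, Opens.infLELeft _ _ ≫ i, k, c, f b * g b', fun x => ?_⟩
    obtain ⟨h, e, hb⟩ := H ⟨x.1, x.2.1⟩
    obtain ⟨h', e', hb'⟩ := H' ⟨x.1, x.2.2⟩
    obtain ⟨l, hl, rfl, rfl⟩ := R e e'
    exact ⟨l, hl, (congrArg₂ (· * ·) hb hb').trans (map_mul l.hom (f b) (g b')).symm⟩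

/-- The structure sheaf of `F(A)` as a presheaf of rings. -/
noncomputable def structurePresheaf (A : RingCat.{u}) : TopCat.Presheaf RingCat.{u} (top A) where
  obj U := RingCat.of (sections A U.unop)
  map {U V} i := RingCat.ofHom
    { toFun := fun t => ⟨fun s => t.1 (i.unop s), (isLocallyFraction A).res i.unop t.1 t.2⟩
      map_one' := rfl
      map_mul' := fun _ _ => rfl
      map_zero' := rfl
      map_add' := fun _ _ => rfl }

theorem isSheaf_structurePresheaf (A : RingCat.{u}) : (structurePresheaf A).IsSheaf :=
  (TopCat.Presheaf.isSheaf_iff_isSheaf_comp (forget RingCat) _).2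
    (TopCat.Presheaf.isSheaf_of_iso
      (NatIso.ofComponents fun _ => Iso.refl _)
      (TopCat.subsheafToTypes (isLocallyFraction A)).property)

/-- The ringed space `(F(A), O_A)`. -/
noncomputable def ringedSpace (A : RingCat.{u}) : AlgebraicGeometry.SheafedSpace RingCat.{u} where
  carrier := top A
  presheaf := structurePresheaf A
  IsSheaf := isSheaf_structurePresheaf A

/-- The homomorphism `O_A(U) → O_B(f⁻¹(U))` induced by `χ : A → B`: the section `t` is sent to
`S ↦ χ^S (t(χ^*(S)))`. -/
noncomputable def sectionsMap (χ : A ⟶ B) (U : Opens (top A)) :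
    sections A U →+* sections B ((Opens.map (topMap χ)).obj U) where
  toFun t := ⟨fun s => pullbackLoc χ s.1 (t.1 ⟨pullback χ s.1, s.2⟩), fun s => by
    obtain ⟨V, hV, i, n, a, b, H⟩ := t.2 ⟨pullback χ s.1, s.2⟩
    refine ⟨(Opens.map (topMap χ)).obj V, hV, (Opens.map (topMap χ)).map i, n,
      (pushFrac χ n a).1, (pushFrac χ n a).2 b, fun x => ?_⟩
    obtain ⟨h, e, hb⟩ := H ⟨pullback χ x.1, x.2⟩
    have hx : x.1 ∈ basicOpen (pushFrac χ n a).1 := by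
      rw [← preimage_basicOpen]; exact ⟨h, e⟩
    obtain ⟨k, hk⟩ := hx
    refine ⟨k, hk, ?_⟩
    exact (congrArg (pullbackLoc χ x.1) hb).trans
      (hom_congr (extends_pullback χ x.1 hk e) b)⟩
  map_one' := Subtype.ext (funext fun _ => map_one (pullbackLoc χ _).hom)
  map_mul' _ _ := Subtype.ext (funext fun _ => map_mul (pullbackLoc χ _).hom _ _)
  map_zero' := Subtype.ext (funext fun _ => map_zero (pullbackLoc χ _).hom)
  map_add' _ _ := Subtype.ext (funext fun _ => map_add (pullbackLoc χ _).hom _ _)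

/-- The morphism of ringed spaces `F(B) → F(A)` induced by `χ : A → B`. -/
noncomputable def ringedSpaceMap (χ : A ⟶ B) : ringedSpace B ⟶ ringedSpace A :=
  InducedCategory.homMk
    { base := topMap χ
      c := { app := fun U => RingCat.ofHom (sectionsMap χ U.unop)
             naturality := fun _ _ _ => rfl } }

/-- Evaluation of germs at a point. -/
noncomputable def stalkEval (s : top A) :
    (structurePresheaf A).stalk s ⟶ FullSpec.loc (A := A) s :=
  Limits.colimit.desc ((OpenNhds.inclusion s).op ⋙ structurePresheaf A)
    { pt := FullSpec.loc (A := A) s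
      ι := { app := fun U => RingCat.ofHom
               ((Pi.evalRingHom _ (⟨s, U.unop.2⟩ : U.unop.1)).comp (sections A U.unop.1).subtype)
             naturality := fun _ _ _ => rfl } }

theorem stalkEval_germ (s : top A) (U : Opens (top A)) (hs : s ∈ U) (t : sections A U) :
    stalkEval s ((structurePresheaf A).germ U s hs t) = t.1 ⟨s, hs⟩ := by
  have h : (structurePresheaf A).germ U s hs ≫ stalkEval s = RingCat.ofHom
      ((Pi.evalRingHom _ (⟨s, hs⟩ : U)).comp (sections A U).subtype) :=
    Limits.colimit.ι_desc (F := (OpenNhds.inclusion s).op ⋙ structurePresheaf A) _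
      (op (⟨U, hs⟩ : OpenNhds s))
  exact hom_congr h t

theorem isUnit_germ (s : top A) (U : Opens (top A)) (hs : s ∈ U) (t : sections A U)
    (ht : IsUnit (t.1 ⟨s, hs⟩)) : IsUnit ((structurePresheaf A).germ U s hs t) := by
  obtain ⟨V, hV, i, n, a, b, H⟩ := t.2 ⟨s, hs⟩
  let D : Opens (top A) := ⟨basicOpen (A := A) (n := n + 1) ⟨a, b⟩, isOpen_basicOpen _⟩
  have hD : s ∈ D := by
    obtain ⟨h, e, hb⟩ := H ⟨s, hV⟩
    obtain ⟨l, hl, -⟩ := e.succ b (by rw [← hb]; exact ht)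
    exact ⟨l, hl⟩
  let W : Opens (top A) := V ⊓ D
  let j : W ⟶ U := Opens.infLELeft _ _ ≫ i
  let xb : Loc _ {b} := Loc.mk _ {b} (FreeAlgebra.ι ℤ (Sum.inr ⟨b, Set.mem_singleton b⟩))
  have h1 : xb * Loc.ι _ {b} b = 1 := by
    rw [Loc.ι_apply, ← map_mul, Loc.mk_rel (.inv_mul ⟨b, Set.mem_singleton b⟩), map_one]
  have h2 : Loc.ι _ {b} b * xb = 1 := by
    rw [Loc.ι_apply, ← map_mul, Loc.mk_rel (.mul_inv ⟨b, Set.mem_singleton b⟩), map_one]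
  choose l hl using fun x : W => x.2.2
  let v : sections A W := ⟨fun x => l x xb, fun x =>
    ⟨W, x.2, 𝟙 _, n + 1, ⟨a, b⟩, xb, fun y => ⟨l y, hl y, rfl⟩⟩⟩
  have hval : ∀ x : W, t.1 (j x) = l x (Loc.ι _ {b} b) := fun x => by
    obtain ⟨h, e, hb⟩ := H ⟨x.1, x.2.1⟩
    obtain ⟨g, e', -, w⟩ := hl x
    have hg : h = g := e.unique e'
    rw [← w] at hg
    exact hb.trans (hom_congr hg b)
  have hu : IsUnit ((structurePresheaf A).map j.op t) := by
    refine isUnit_iff_exists.2 ⟨v, ?_, ?_⟩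
    · refine Subtype.ext (funext fun x => ?_)
      refine (congrArg (· * l x xb) (hval x)).trans ?_
      exact (map_mul (l x).hom _ _).symm.trans ((congrArg (l x) h2).trans (map_one (l x).hom))
    · refine Subtype.ext (funext fun x => ?_)
      refine (congrArg (l x xb * ·) (hval x)).trans ?_
      exact (map_mul (l x).hom _ _).symm.trans ((congrArg (l x) h1).trans (map_one (l x).hom))
  have hg := hu.map ((structurePresheaf A).germ W s ⟨hV, hD⟩).hom
  have e := (structurePresheaf A).germ_res j s ⟨hV, hD⟩
  rw [← e]
  exact hg

theorem isLocalHom_ringedSpaceMap (χ : A ⟶ B) (s : ringedSpace B) :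
    IsLocalHom ((ringedSpaceMap χ).hom.stalkMap s).hom := by
  refine ⟨fun z hz => ?_⟩
  obtain ⟨U, hU, t, rfl⟩ := TopCat.Presheaf.exists_germ_eq (structurePresheaf A)
    (x := pullback χ s) z
  have h1 := AlgebraicGeometry.PresheafedSpace.stalkMap_germ (ringedSpaceMap χ).hom U s hU
  have h2 : IsUnit ((structurePresheaf B).germ ((Opens.map (topMap χ)).obj U) s hU
      (sectionsMap χ U t)) := by
    have h3 := hom_congr h1 t
    exact h3 ▸ hz
  have h4 := h2.map (stalkEval s).hom
  have h5 : IsUnit (pullbackLoc χ s (t.1 ⟨pullback χ s, hU⟩)) :=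
    (congrArg IsUnit (stalkEval_germ s _ hU (sectionsMap χ U t))).mp h4
  exact isUnit_germ _ U hU t ((isLocalHom_pullbackLoc χ s).map_nonunit _ h5)

end FullSpec

/-! ### The category of F-schemes -/

/-- An F-scheme: a ringed space (with a sheaf of not necessarily commutative rings) which is
locally isomorphic, as a ringed space, to `F(A)` for some ring `A`. -/
structure FScheme extends AlgebraicGeometry.SheafedSpace RingCat.{u} where
  local_affine : ∀ x : toSheafedSpace, ∃ (U : OpenNhds x) (A : RingCat.{u}),
    Nonempty (toSheafedSpace.restrict U.isOpenEmbedding ≅ FullSpec.ringedSpace A)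

namespace FScheme

/-- A morphism of F-schemes: a morphism of ringed spaces which induces local homomorphisms on the
stalks. -/
@[ext]
structure Hom (X Y : FScheme.{u}) : Type u where
  toRingedSpaceHom : X.toSheafedSpace ⟶ Y.toSheafedSpace
  isLocal : ∀ x : X.toSheafedSpace, IsLocalHom (toRingedSpaceHom.hom.stalkMap x).hom

/-- The category **FSch** of F-schemes. -/
instance : Category FScheme.{u} where
  Hom := Hom
  id X := ⟨𝟙 _, fun x => by
    have := AlgebraicGeometry.PresheafedSpace.stalkMap.id X.toPresheafedSpace x
    refine ⟨fun z hz => ?_⟩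
    exact (congrArg IsUnit (hom_congr this z)).mp hz⟩
  comp {X Y Z} f g := ⟨f.toRingedSpaceHom ≫ g.toRingedSpaceHom, fun x => by
    have := AlgebraicGeometry.PresheafedSpace.stalkMap.comp f.toRingedSpaceHom.hom
      g.toRingedSpaceHom.hom x
    refine ⟨fun z hz => ?_⟩
    refine (g.isLocal _).map_nonunit _ ((f.isLocal x).map_nonunit _ ?_)
    exact (hom_congr this z) ▸ hz⟩

/-- The affine F-scheme `F(A)`. -/
noncomputable def spec (A : RingCat.{u}) : FScheme.{u} where
  toSheafedSpace := FullSpec.ringedSpace A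
  local_affine _ := ⟨⟨⊤, trivial⟩, A, ⟨(FullSpec.ringedSpace A).restrictTopIso⟩⟩

/-- The morphism `F(B) → F(A)` of F-schemes induced by a ring homomorphism `χ : A → B`. -/
noncomputable def specMap {A B : RingCat.{u}} (χ : A ⟶ B) : spec B ⟶ spec A :=
  Hom.mk (FullSpec.ringedSpaceMap χ) (FullSpec.isLocalHom_ringedSpaceMap χ)

end FScheme

end FSchemes

namespace FSchemes

open AlgebraicGeometry

/-! ### Complements on fully invertible systems and fractions -/

/-! The fiber product is built in one stroke, without gluing, in the larger category `LocSpace` of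
ringed spaces with nonzero stalks and morphisms that are local on stalks. F-schemes form a full
subcategory of it, and it remains to see that the fiber product of F-schemes is again locally
affine.

The algebraic basis is that a fully invertible system is a homomorphism to a nonzero ring,
considered up to local homomorphisms. Following `φ` by a local homomorphism does not change its
system (`ofHom_comp_local`), the system `S` comes from `A → A_S` (`ofHom_toLoc`), and every
homomorphism with system `S` factors through `A_S` by a local homomorphism (`exists_descOf`),
uniquely because `A → A_S` is an epimorphism (`loc_hom_ext`). The maps `A → A_a` are epimorphisms
too, so homomorphisms out of `A_a` may be compared on `A`.

A local morphism from `T` into `X ×_Y Z` should give, at each `t`, points `x`, `z` with the same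
image `y` and a homomorphism `O_x *_{O_y} O_z → O_t`; up to local homomorphisms this is a system on
the pushout. So a point of the fiber product (`FibPt`) is a triple of `x`, `z` and a system on the
pushout of stalks for which `O_x` and `O_z` map locally to the localization. Topology and structure
sheaf are defined by fractions of the coproducts `O(U) * O(V)`, as `F(A)` is defined by fractions of
`A`. The stalks are the expected localizations (`isIso_eval`), and the universal property follows
(`isPullback_fib`).

In the affine case `F(R)` represents the functor `T ↦ Hom(R, Γ(T))` on `LocSpace` (`toΓ_injective`,
`exists_toΓ`), so `F` turns pushouts of rings into pullbacks. Moreover `Γ(F(A)) = A`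
(`isIso_globalSection`), so morphisms between affine F-schemes are ring homomorphisms. For general
F-schemes, affine open subspaces form a basis, and the fiber product of affine pieces is open in the
whole fiber product (`exists_isPullback_restrict`); by uniqueness this piece is some `F(A *_R B)`.
-/

theorem isLocalHom_of_comp {A B C : RingCat.{u}} (f : A ⟶ B) (g : B ⟶ C)
    (h : IsLocalHom (f ≫ g).hom) : IsLocalHom f.hom :=
  ⟨fun a ha => h.map_nonunit a (show IsUnit (g.hom (f.hom a)) from ha.map g.hom)⟩

theorem isLocalHom_comp {A B C : RingCat.{u}} (f : A ⟶ B) (g : B ⟶ C)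
    (hf : IsLocalHom f.hom) (hg : IsLocalHom g.hom) : IsLocalHom (f ≫ g).hom :=
  ⟨fun _ ha => hf.map_nonunit _ (hg.map_nonunit _ ha)⟩

theorem isLocalHom_iso {A B : RingCat.{u}} (f : A ⟶ B) [IsIso f] : IsLocalHom f.hom :=
  isLocalHom_of_comp f (inv f) (by
    rw [IsIso.hom_inv_id]; exact ⟨fun _ h => h⟩)

/-- The recursion step in the construction of `sysOf`. -/
noncomputable def sysStep {A B : RingCat.{u}} {n : ℕ}
    (y : Σ x : (sysLevel A n).idx, ((sysLevel A n).ring x ⟶ B)) :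
    Σ x : (sysLevel A (n + 1)).idx, ((sysLevel A (n + 1)).ring x ⟶ B) :=
  ⟨⟨y.1, {a | IsUnit (y.2 a)}⟩, Loc.lift y.2 (fun _ hs => hs)⟩

/-- A local `ψ` reflects units, so `f` and `f ≫ ψ` invert the same elements and define the same next
localization. -/
theorem sysStep_comp {A B C : RingCat.{u}} (ψ : B ⟶ C) (hψ : IsLocalHom ψ.hom) {n : ℕ}
    (x : (sysLevel A n).idx) (f : (sysLevel A n).ring x ⟶ B) :
    sysStep (⟨x, f ≫ ψ⟩ : Σ x : (sysLevel A n).idx, ((sysLevel A n).ring x ⟶ C)) =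
      ⟨(sysStep ⟨x, f⟩).1, (sysStep ⟨x, f⟩).2 ≫ ψ⟩ := by
  -- The two sets are replaced by variables so that their equality can be eliminated inside the
  -- dependent pair.
  have key : ∀ (S T : Set ((sysLevel A n).ring x)) (hS : ∀ s ∈ S, IsUnit ((f ≫ ψ) s))
      (hT : ∀ s ∈ T, IsUnit (f s)), S = T →
      (⟨⟨x, S⟩, Loc.lift (f ≫ ψ) hS⟩ :
        Σ x : (sysLevel A (n + 1)).idx, ((sysLevel A (n + 1)).ring x ⟶ C)) =
      ⟨⟨x, T⟩, Loc.lift f hT ≫ ψ⟩ := by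
    rintro S _ hS hT rfl
    exact congrArg (Sigma.mk _) (Loc.hom_ext ((Loc.ι_lift _ _).trans
      ((congrArg (fun k => k ≫ ψ) (Loc.ι_lift f hT)).symm.trans (Category.assoc _ _ _))))
  exact key _ _ _ _ (Set.ext fun a => ⟨fun h => hψ.map_nonunit _ h, fun h => h.map ψ.hom⟩)

theorem sysOf_comp {A B C : RingCat.{u}} (φ : A ⟶ B) (ψ : B ⟶ C) (hψ : IsLocalHom ψ.hom) :
    ∀ n : ℕ, sysOf (φ ≫ ψ) n = ⟨(sysOf φ n).1, (sysOf φ n).2 ≫ ψ⟩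
  | 0 => rfl
  | n + 1 => (congrArg sysStep (sysOf_comp φ ψ hψ n)).trans (sysStep_comp ψ hψ _ _)

namespace FullSpec

variable {A B C : RingCat.{u}}

theorem ofHom_comp_local (φ : A ⟶ B) (ψ : B ⟶ C) (hB : Nontrivial B) (hC : Nontrivial C)
    (hψ : IsLocalHom ψ.hom) : ofHom (φ ≫ ψ) hC = ofHom φ hB :=
  Subtype.ext (funext fun n => congrArg Sigma.fst (sysOf_comp φ ψ hψ n))

/-- If `S` comes from `φ : A → B`, then `φ` is `A → A_S` followed by the local homomorphism `desc
φ`, so both have the same system. -/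
theorem ofHom_toLoc (s : FullSpec A) : ofHom s.toLoc s.nontrivial_loc = s := by
  obtain ⟨s, B, φ, hB, rfl⟩ := s
  have h := ofHom_comp_local (ofHom φ hB).toLoc (desc φ hB) (nontrivial_loc _) hB
    (isLocalHom_desc φ hB)
  have e : ∀ (φ' : A ⟶ B), φ' = φ → ofHom φ' hB = ofHom φ hB := by rintro _ rfl; rfl
  exact h.symm.trans (e _ (toLoc_desc φ hB))

/-- A universal localization is an epimorphism; this passes through all stages and then to the
direct limit. -/
theorem loc_hom_ext {s : FullSpec A} {f g : s.loc ⟶ B} (h : s.toLoc ≫ f = s.toLoc ≫ g) :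
    f = g := by
  have key : ∀ n, s.ofStage n ≫ f = s.ofStage n ≫ g := by
    intro n
    induction n with
    | zero => exact h
    | succ n ih =>
      apply Loc.hom_ext
      rw [← s.stageMap_ofStage n] at ih
      refine (cancel_epi (eqToHom (congrArg (sysLevel A n).ring (s.succ_fst n).symm))).1 ?_
      exact ih
  exact Limits.colimit.hom_ext fun n => key n

/-- The system enters through an equation, so that the factorization applies to a given point known
only afterwards to be the system of `φ`. -/
theorem exists_descOf (s : FullSpec A) (φ : A ⟶ B) (hB : Nontrivial B) (h : ofHom φ hB = s) :
    ∃ ψ : s.loc ⟶ B, s.toLoc ≫ ψ = φ ∧ IsLocalHom ψ.hom := by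
  subst h
  exact ⟨desc φ hB, toLoc_desc φ hB, isLocalHom_desc φ hB⟩

theorem ofHom_eq_of_local (s : FullSpec A) (ψ : s.loc ⟶ B) (hψ : IsLocalHom ψ.hom)
    (hB : Nontrivial B) : ofHom (s.toLoc ≫ ψ) hB = s :=
  (ofHom_comp_local s.toLoc ψ s.nontrivial_loc hB hψ).trans (ofHom_toLoc s)

/-- A local homomorphism out of `A_S` remembers `S`: it is the system of the composite from `A`.
Uniqueness of morphisms on points rests on this. -/
theorem eq_of_local (s s' : FullSpec A) (ψ : s.loc ⟶ B) (ψ' : s'.loc ⟶ B) (hψ : IsLocalHom ψ.hom)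
    (hψ' : IsLocalHom ψ'.hom) (hB : Nontrivial B) (h : s.toLoc ≫ ψ = s'.toLoc ≫ ψ') : s = s' := by
  rw [← ofHom_eq_of_local s ψ hψ hB, ← ofHom_eq_of_local s' ψ' hψ' hB]
  congr 1

end FullSpec

/-- The canonical homomorphism `A → A_a`. -/
def fracι (A : RingCat.{u}) : (n : ℕ) → (a : (fracLevel A n).idx) → (A ⟶ (fracLevel A n).ring a)
  | 0, _ => 𝟙 A
  | n + 1, a => fracι A n a.1 ≫ Loc.ι _ {a.2}

section

variable {A B C : RingCat.{u}}

theorem extends_fracι : ∀ (n : ℕ) (a : (fracLevel A n).idx), Extends (fracι A n a) n a (𝟙 _)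
  | 0, _ => rfl
  | n + 1, a => ⟨Loc.ι _ {a.2}, by
      have := (extends_fracι n a.1).comp (Loc.ι _ {a.2})
      rwa [Category.id_comp] at this, Loc.isUnit_ι (Set.mem_singleton _), Category.comp_id _⟩

theorem extends_fracι_comp {n : ℕ} (a : (fracLevel A n).idx) (h : (fracLevel A n).ring a ⟶ B) :
    Extends (fracι A n a ≫ h) n a h := by
  have := (extends_fracι n a).comp h
  rwa [Category.id_comp] at this

/-- `A → A_a` is an epimorphism, since the extension of a homomorphism to `A_a` is unique. This is
the main tool for comparing sections given by fractions. -/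
theorem frac_hom_ext {n : ℕ} {a : (fracLevel A n).idx} {h h' : (fracLevel A n).ring a ⟶ B}
    (e : fracι A n a ≫ h = fracι A n a ≫ h') : h = h' := by
  have h1 := extends_fracι_comp a h
  rw [e] at h1
  exact h1.unique (extends_fracι_comp a h')

theorem Extends.fracι_comp {φ : A ⟶ B} : ∀ {n : ℕ} {a : (fracLevel A n).idx}
    {h : (fracLevel A n).ring a ⟶ B}, Extends φ n a h → fracι A n a ≫ h = φ
  | 0, _, _, e => (Category.id_comp _).trans e
  | n + 1, a, h, ⟨g, e, _, w⟩ => by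
    rw [← e.fracι_comp, ← w]
    exact Category.assoc _ _ _

end

/-! ### Sections and germs on ringed spaces -/

namespace RingedSp

variable (X : SheafedSpace RingCat.{u})

/-- The germ of a section at a point. -/
noncomputable abbrev germ (U : Opens X) (x : X) (hx : x ∈ U) :
    X.presheaf.obj (op U) ⟶ X.presheaf.stalk x := X.presheaf.germ U x hx

variable {X}

theorem section_ext {U : Opens X} {s t : X.presheaf.obj (op U)}
    (h : ∀ (x : X) (hx : x ∈ U), germ X U x hx s = germ X U x hx t) : s = t :=
  TopCat.Presheaf.section_ext X.sheaf U s t h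

theorem germ_res_apply {U V : Opens X} (i : V ⟶ U) (x : X) (hx : x ∈ V)
    (s : X.presheaf.obj (op U)) :
    germ X V x hx (X.presheaf.map i.op s) = germ X U x (i.le hx) s :=
  hom_congr (X.presheaf.germ_res i x hx) s

/-- A family of germs which is locally given by sections comes from a section. -/
theorem exists_section_of_germs (U : Opens X) (g : ∀ x : X, x ∈ U → X.presheaf.stalk x)
    (H : ∀ x ∈ U, ∃ (V : Opens X) (_ : x ∈ V) (i : V ≤ U) (s : X.presheaf.obj (op V)),
      ∀ (y : X) (hy : y ∈ V), germ X V y hy s = g y (i hy)) :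
    ∃ s : X.presheaf.obj (op U), ∀ (x : X) (hx : x ∈ U), germ X U x hx s = g x hx := by
  choose V hV i s hs using H
  obtain ⟨t, ht, -⟩ := X.sheaf.existsUnique_gluing' (fun x : U => V x.1 x.2) U
    (fun x => homOfLE (i x.1 x.2))
    (fun x hx => Opens.mem_iSup.2 ⟨⟨x, hx⟩, hV x hx⟩) (fun x => s x.1 x.2) (by
      intro x y
      refine section_ext fun z hz => ?_
      exact (germ_res_apply _ z hz _).trans ((hs _ _ _ _).trans
        ((hs _ _ _ _).symm.trans (germ_res_apply _ z hz _).symm)))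
  refine ⟨t, fun x hx => ?_⟩
  rw [← hs x hx x (hV x hx), ← ht ⟨x, hx⟩]
  exact (germ_res_apply (homOfLE (i x hx)) x (hV x hx) t).symm

/-- A section which is invertible at a point is invertible on a neighborhood. -/
theorem exists_isUnit_res {U : Opens X} (s : X.presheaf.obj (op U)) (x : X) (hx : x ∈ U)
    (h : IsUnit (germ X U x hx s)) :
    ∃ (V : Opens X) (_ : x ∈ V) (i : V ⟶ U), IsUnit (X.presheaf.map i.op s) := by
  obtain ⟨b, hb1, hb2⟩ := isUnit_iff_exists.1 h
  obtain ⟨V, hV, t, rfl⟩ := X.presheaf.exists_germ_eq b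
  let W := U ⊓ V
  let iU : W ⟶ U := Opens.infLELeft U V
  let iV : W ⟶ V := Opens.infLERight U V
  have hW : x ∈ W := ⟨hx, hV⟩
  have e1 : germ X W x hW (X.presheaf.map iU.op s * X.presheaf.map iV.op t) =
      germ X W x hW 1 := by
    rw [map_mul, map_one, germ_res_apply, germ_res_apply]; exact hb1
  have e2 : germ X W x hW (X.presheaf.map iV.op t * X.presheaf.map iU.op s) =
      germ X W x hW 1 := by
    rw [map_mul, map_one, germ_res_apply, germ_res_apply]; exact hb2
  obtain ⟨W1, hW1, i1, i1', h1⟩ := X.presheaf.germ_eq x hW hW _ _ e1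
  obtain ⟨W2, hW2, i2, i2', h2⟩ := X.presheaf.germ_eq x hW hW _ _ e2
  have q1 : ∀ {W' : Opens X} (j : W' ⟶ W), X.presheaf.map j.op (X.presheaf.map iU.op s) =
      X.presheaf.map (j ≫ iU).op s := fun j => by
    rw [op_comp, X.presheaf.map_comp]; rfl
  -- The two products become 1 on `W1` and on `W2` respectively; in a noncommutative ring both are
  -- needed, hence the intersection.
  refine ⟨W1 ⊓ W2, ⟨hW1, hW2⟩, (Opens.infLELeft W1 W2 ≫ i1) ≫ iU, ?_⟩
  refine isUnit_iff_exists.2 ⟨X.presheaf.map (Opens.infLELeft W1 W2 ≫ i1).op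
    (X.presheaf.map iV.op t), ?_, ?_⟩
  · rw [← q1, ← map_mul, op_comp, X.presheaf.map_comp]
    change X.presheaf.map _ (X.presheaf.map i1.op _) = 1
    rw [h1, map_one, map_one]
  · rw [← q1, ← map_mul]
    have : Opens.infLELeft W1 W2 ≫ i1 = Opens.infLERight W1 W2 ≫ i2 := rfl
    rw [this, op_comp, X.presheaf.map_comp]
    change X.presheaf.map _ (X.presheaf.map i2.op _) = 1
    rw [h2, map_one, map_one]

/-- A section all of whose germs are invertible is invertible. -/
theorem isUnit_of_germ {U : Opens X} (s : X.presheaf.obj (op U))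
    (h : ∀ (x : X) (hx : x ∈ U), IsUnit (germ X U x hx s)) : IsUnit s := by
  obtain ⟨t, ht⟩ := exists_section_of_germs U (fun x hx => ((h x hx).unit⁻¹ : _)) (by
    intro x hx
    obtain ⟨V, hV, i, hi⟩ := exists_isUnit_res s x hx (h x hx)
    refine ⟨V, hV, i.le, (hi.unit⁻¹ : _), fun y hy => ?_⟩
    refine left_inv_eq_right_inv (a := germ X U y (i.le hy) s) ?_ (h y (i.le hy)).mul_val_inv
    rw [← germ_res_apply i y hy s, ← map_mul, hi.val_inv_mul, map_one])
  refine isUnit_iff_exists.2 ⟨t, ?_, ?_⟩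
  · refine section_ext fun x hx => ?_
    rw [map_mul, ht, map_one]; exact (h x hx).mul_val_inv
  · refine section_ext fun x hx => ?_
    rw [map_mul, ht, map_one]; exact (h x hx).val_inv_mul

/-- The open set on which a section is invertible. -/
def unitLocus {U : Opens X} (s : X.presheaf.obj (op U)) : Opens X where
  carrier := {x | ∃ hx : x ∈ U, IsUnit (germ X U x hx s)}
  is_open' := by
    refine isOpen_iff_forall_mem_open.2 ?_
    rintro x ⟨hx, h⟩
    obtain ⟨V, hV, i, hi⟩ := exists_isUnit_res s x hx h
    refine ⟨V, fun y hy => ⟨i.le hy, ?_⟩, V.2, hV⟩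
    rw [← germ_res_apply i y hy s]
    exact hi.map (germ X V y hy).hom

theorem unitLocus_le {U : Opens X} (s : X.presheaf.obj (op U)) : unitLocus s ≤ U :=
  fun _ hx => hx.1

theorem isUnit_res_unitLocus {U : Opens X} (s : X.presheaf.obj (op U)) :
    IsUnit (X.presheaf.map (homOfLE (unitLocus_le s)).op s) :=
  isUnit_of_germ _ fun x hx => by
    rw [germ_res_apply]; exact hx.2

/-- For `φ : R → O(U)` and a fraction `a` of `R`, there is a largest open subset of `U` on which
the entries of `a` successively become invertible. -/
theorem exists_extends {R : RingCat.{u}} {U : Opens X} (φ : R ⟶ X.presheaf.obj (op U)) :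
    ∀ (n : ℕ) (a : (fracLevel R n).idx), ∃ (W : Opens X) (i : W ⟶ U)
      (ψ : (fracLevel R n).ring a ⟶ X.presheaf.obj (op W)),
      Extends (φ ≫ X.presheaf.map i.op) n a ψ ∧
      ∀ (x : X) (hx : x ∈ U), (∃ h, Extends (φ ≫ germ X U x hx) n a h) → x ∈ W
  | 0, _ => ⟨U, 𝟙 U, φ, by
      change φ = _
      rw [op_id, X.presheaf.map_id, Category.comp_id], fun _ hx _ => hx⟩
  | n + 1, a => by
    obtain ⟨W, i, ψ, hψ, hW⟩ := exists_extends φ n a.1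
    -- The last entry is a section over `W`; the required open set is the locus where that section
    -- is invertible.
    let j := homOfLE (unitLocus_le (ψ a.2))
    have e := hψ.comp (X.presheaf.map j.op)
    rw [Category.assoc, ← X.presheaf.map_comp, ← op_comp] at e
    obtain ⟨k, hk, -⟩ := e.succ a.2 (isUnit_res_unitLocus (ψ a.2))
    refine ⟨unitLocus (ψ a.2), j ≫ i, k, hk, ?_⟩
    rintro x hx ⟨h, g, hg, hu, w⟩
    have hxW := hW x hx ⟨g, hg⟩
    have e' := hψ.comp (germ X W x hxW)
    rw [Category.assoc] at e'
    have : X.presheaf.map i.op ≫ germ X W x hxW = germ X U x hx := X.presheaf.germ_res i x hxW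
    rw [this] at e'
    -- Extensions are unique, so the given one at `x` is the germ of `ψ`, and its last entry is a
    -- unit exactly when `x` lies in the locus.
    refine ⟨hxW, ?_⟩
    rw [hg.unique e'] at hu
    exact hu

end RingedSp

/-! ### Morphisms of ringed spaces and their stalk homomorphisms -/

namespace RingedSp

variable {T Q : SheafedSpace RingCat.{u}}

theorem stalkMap_germ (f : T ⟶ Q) (U : Opens Q) (t : T) (ht : f.hom.base t ∈ U)
    (s : Q.presheaf.obj (op U)) :
    f.hom.stalkMap t (germ Q U _ ht s) =
      germ T ((Opens.map f.hom.base).obj U) t ht (f.hom.c.app (op U) s) :=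
  hom_congr (PresheafedSpace.stalkMap_germ f.hom U t ht) s

/-- Morphisms of ringed spaces are determined by their effect on points and germs. -/
theorem hom_ext {f g : T ⟶ Q} (hb : ∀ t : T, f.hom.base t = g.hom.base t)
    (hs : ∀ (U : Opens Q) (s : Q.presheaf.obj (op U)) (t : T) (hf : f.hom.base t ∈ U)
      (hg : g.hom.base t ∈ U),
      f.hom.stalkMap t (germ Q U _ hf s) = g.hom.stalkMap t (germ Q U _ hg s)) : f = g := by
  simp only [stalkMap_germ] at hs
  obtain ⟨⟨b, c⟩⟩ := f
  obtain ⟨⟨b', c'⟩⟩ := g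
  obtain rfl : b = b' := by ext t; exact hb t
  have : c = c' := by
    refine NatTrans.ext (funext fun U => RingCat.hom_ext (RingHom.ext fun s => ?_))
    exact section_ext (X := T) fun t ht => hs U.unop s t ht ht
  subst this
  rfl

section HomOfStalks

variable (h : (T : TopCat.{u}) ⟶ (Q : TopCat.{u}))
  (κ : ∀ t : T, Q.presheaf.stalk (h t) ⟶ T.presheaf.stalk t)
  (H : ∀ (U : Opens Q) (s : Q.presheaf.obj (op U)) (t : T), h t ∈ U →
    ∃ (V : Opens T) (_ : t ∈ V) (r : T.presheaf.obj (op V)), ∀ (y : T) (hy : y ∈ V)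
      (hU : h y ∈ U), germ T V y hy r = κ y (germ Q U (h y) hU s))

-- The hypothesis `H` says that `κ` carries sections to germs of sections locally; such families of
-- germs glue.
include H in
theorem exists_app (U : Opens Q) (s : Q.presheaf.obj (op U)) :
    ∃ r : T.presheaf.obj (op ((Opens.map h).obj U)), ∀ (y : T) (hy : h y ∈ U),
      germ T ((Opens.map h).obj U) y hy r = κ y (germ Q U (h y) hy s) :=
  exists_section_of_germs _ (fun y hy => κ y (germ Q U (h y) hy s)) fun y hy => by
    obtain ⟨V, hV, r, hr⟩ := H U s y hy
    let i : V ⊓ (Opens.map h).obj U ⟶ V := Opens.infLELeft _ _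
    exact ⟨V ⊓ (Opens.map h).obj U, ⟨hV, hy⟩, fun _ hz => hz.2, T.presheaf.map i.op r,
      fun z hz => (germ_res_apply i z hz r).trans (hr z hz.1 hz.2)⟩

/-- The morphism of ringed spaces given by a continuous map and homomorphisms of stalks. -/
noncomputable def homOfStalks : T ⟶ Q :=
  InducedCategory.homMk
    { base := h
      c :=
        { app := fun U => RingCat.ofHom
            { toFun := fun s => (exists_app h κ H U.unop s).choose
              map_one' := section_ext fun y hy => by
                rw [(exists_app h κ H U.unop 1).choose_spec y hy, map_one, map_one, map_one]
              map_mul' := fun s s' => section_ext fun y hy => by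
                rw [(exists_app h κ H U.unop (s * s')).choose_spec y hy, map_mul, map_mul, map_mul,
                  (exists_app h κ H U.unop s).choose_spec y hy,
                  (exists_app h κ H U.unop s').choose_spec y hy]
              map_zero' := section_ext fun y hy => by
                rw [(exists_app h κ H U.unop 0).choose_spec y hy, map_zero, map_zero, map_zero]
              map_add' := fun s s' => section_ext fun y hy => by
                rw [(exists_app h κ H U.unop (s + s')).choose_spec y hy, map_add, map_add, map_add,
                  (exists_app h κ H U.unop s).choose_spec y hy,
                  (exists_app h κ H U.unop s').choose_spec y hy] }
          naturality := fun U V i => RingCat.hom_ext (RingHom.ext fun s =>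
            section_ext (X := T) fun y hy => by
              refine ((exists_app h κ H V.unop (Q.presheaf.map i s)).choose_spec y hy).trans ?_
              have e := germ_res_apply i.unop (h y) hy s
              refine (congrArg (κ y) e).trans ?_
              refine ((exists_app h κ H U.unop s).choose_spec y (i.unop.le hy)).symm.trans ?_
              exact (germ_res_apply ((Opens.map h).map i.unop) y hy _).symm) } }

theorem homOfStalks_stalkMap (t : T) : (homOfStalks h κ H).hom.stalkMap t = κ t := by
  refine TopCat.Presheaf.stalk_hom_ext _ fun U hU => RingCat.hom_ext (RingHom.ext fun s => ?_)
  exact (stalkMap_germ (homOfStalks h κ H) U t hU s).trans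
    ((exists_app h κ H U s).choose_spec t hU)

end HomOfStalks

end RingedSp

/-! ### Ringed spaces with nonzero stalks and local morphisms -/

/-- A ringed space all of whose stalks are nonzero. -/
structure LocSpace extends SheafedSpace RingCat.{u} where
  nontrivial_stalk : ∀ x : toSheafedSpace, Nontrivial (presheaf.stalk x)

namespace LocSpace

/-- A morphism of ringed spaces which induces local homomorphisms on the stalks. -/
@[ext]
structure Hom (X Y : LocSpace.{u}) : Type u where
  toRingedSpaceHom : X.toSheafedSpace ⟶ Y.toSheafedSpace
  isLocal : ∀ x : X.toSheafedSpace, IsLocalHom (toRingedSpaceHom.hom.stalkMap x).hom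

theorem isLocal_id (X : SheafedSpace RingCat.{u}) (x : X) :
    IsLocalHom ((𝟙 X : X ⟶ X).hom.stalkMap x).hom :=
  ⟨fun z hz => (congrArg IsUnit
    (hom_congr (PresheafedSpace.stalkMap.id X.toPresheafedSpace x) z)).mp hz⟩

theorem stalkMap_comp_apply {X Y Z : SheafedSpace RingCat.{u}} (f : X ⟶ Y) (g : Y ⟶ Z) (x : X)
    (z : Z.presheaf.stalk (g.hom.base (f.hom.base x))) :
    (f ≫ g).hom.stalkMap x z = f.hom.stalkMap x (g.hom.stalkMap (f.hom.base x) z) :=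
  hom_congr (PresheafedSpace.stalkMap.comp f.hom g.hom x) z

theorem isLocal_comp {X Y Z : SheafedSpace RingCat.{u}} (f : X ⟶ Y) (g : Y ⟶ Z)
    (hf : ∀ x : X, IsLocalHom (f.hom.stalkMap x).hom)
    (hg : ∀ y : Y, IsLocalHom (g.hom.stalkMap y).hom) (x : X) :
    IsLocalHom ((f ≫ g).hom.stalkMap x).hom :=
  ⟨fun z hz => (hg _).map_nonunit _ ((hf x).map_nonunit _
    ((congrArg IsUnit (stalkMap_comp_apply f g x z)).mp hz))⟩

theorem isLocal_of_comp {X Y Z : SheafedSpace RingCat.{u}} (f : X ⟶ Y) (g : Y ⟶ Z)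
    (h : ∀ x : X, IsLocalHom ((f ≫ g).hom.stalkMap x).hom)
    (hg : ∀ y : Y, IsIso (g.hom.stalkMap y)) (x : X) : IsLocalHom (f.hom.stalkMap x).hom := by
  refine ⟨fun z hz => ?_⟩
  have := hg (f.hom.base x)
  obtain ⟨w, rfl⟩ : ∃ w, g.hom.stalkMap (f.hom.base x) w = z :=
    ⟨inv (g.hom.stalkMap (f.hom.base x)) z,
      hom_congr (IsIso.inv_hom_id (g.hom.stalkMap (f.hom.base x))) z⟩
  exact ((h x).map_nonunit w ((congrArg IsUnit (stalkMap_comp_apply f g x w)).mpr hz)).map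
    (g.hom.stalkMap (f.hom.base x)).hom

instance : Category LocSpace.{u} where
  Hom := Hom
  id X := ⟨𝟙 _, isLocal_id _⟩
  comp f g := ⟨f.toRingedSpaceHom ≫ g.toRingedSpaceHom, isLocal_comp _ _ f.isLocal g.isLocal⟩

theorem hom_ext {X Y : LocSpace.{u}} {f g : X ⟶ Y}
    (h : f.toRingedSpaceHom = g.toRingedSpaceHom) : f = g := Hom.ext h

/-- The underlying map of points. -/
noncomputable abbrev pt {X Y : LocSpace.{u}} (f : X ⟶ Y) : X.toSheafedSpace → Y.toSheafedSpace :=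
  f.toRingedSpaceHom.hom.base

/-- The homomorphism of stalks at a point. -/
noncomputable abbrev stalkMap {X Y : LocSpace.{u}} (f : X ⟶ Y) (x : X.toSheafedSpace) :
    Y.presheaf.stalk (pt f x) ⟶ X.presheaf.stalk x :=
  f.toRingedSpaceHom.hom.stalkMap x

end LocSpace

/-! ### The ringed space `F(A)` -/

namespace FullSpec

open RingedSp

variable {A B : RingCat.{u}}

/-- The homomorphism `A_a → O_A(V)` for `V ⊆ D(a)`. -/
noncomputable def fracSection (V : Opens (ringedSpace A)) {n : ℕ} (a : (fracLevel A n).idx)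
    (hV : ∀ s : V, ∃ h, Extends (toLoc (A := A) s.1) n a h) :
    (fracLevel A n).ring a ⟶ (ringedSpace A).presheaf.obj (op V) :=
  RingCat.ofHom
    { toFun := fun b => (⟨fun s => (hV s).choose b, fun s => ⟨V, s.2, 𝟙 _, n, a, b, fun x =>
        ⟨(hV x).choose, (hV x).choose_spec, rfl⟩⟩⟩ : sections A V)
      map_one' := Subtype.ext (funext fun s => map_one (hV s).choose.hom)
      map_mul' := fun _ _ => Subtype.ext (funext fun s => map_mul (hV s).choose.hom _ _)
      map_zero' := Subtype.ext (funext fun s => map_zero (hV s).choose.hom)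
      map_add' := fun _ _ => Subtype.ext (funext fun s => map_add (hV s).choose.hom _ _) }

/-- The homomorphism from `A` to the global sections of `F(A)`. -/
noncomputable def globalSection (A : RingCat.{u}) :
    A ⟶ (ringedSpace A).presheaf.obj (op ⊤) :=
  RingCat.ofHom
    { toFun := fun b => (⟨fun s => toLoc s.1 b, fun s => ⟨⊤, s.2, 𝟙 _, 0, PUnit.unit, b, fun x =>
        ⟨toLoc x.1, rfl, rfl⟩⟩⟩ : sections A ⊤)
      map_one' := Subtype.ext (funext fun s => map_one (toLoc s.1).hom)
      map_mul' := fun _ _ => Subtype.ext (funext fun s => map_mul (toLoc s.1).hom _ _)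
      map_zero' := Subtype.ext (funext fun s => map_zero (toLoc s.1).hom)
      map_add' := fun _ _ => Subtype.ext (funext fun s => map_add (toLoc s.1).hom _ _) }

/-- The homomorphism from `A` to the stalks of `F(A)`. -/
noncomputable def toStalk (s : ringedSpace A) : A ⟶ (ringedSpace A).presheaf.stalk s :=
  globalSection A ≫ germ (ringedSpace A) ⊤ s trivial

/-- The localization of `A` at a point of `F(A)`. -/
noncomputable def locAt (s : ringedSpace A) : RingCat.{u} := FullSpec.loc (A := A) s

/-- The canonical homomorphism to the localization at a point of `F(A)`. -/
noncomputable def toLocAt (s : ringedSpace A) : A ⟶ locAt s := FullSpec.toLoc (A := A) s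

/-- Evaluation of germs at a point of `F(A)`. -/
noncomputable def evalAt (s : ringedSpace A) : (ringedSpace A).presheaf.stalk s ⟶ locAt s :=
  stalkEval s

theorem evalAt_germ (s : ringedSpace A) (U : Opens (ringedSpace A)) (hs : s ∈ U)
    (t : sections A U) : evalAt s (germ (ringedSpace A) U s hs t) = t.1 ⟨s, hs⟩ :=
  stalkEval_germ s U hs t

theorem nontrivial_locAt (s : ringedSpace A) : Nontrivial (locAt s) :=
  FullSpec.nontrivial_loc (A := A) s

theorem locAt_hom_ext {s : ringedSpace A} {f g : locAt s ⟶ B}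
    (h : toLocAt s ≫ f = toLocAt s ≫ g) : f = g := loc_hom_ext (A := A) h

theorem toStalk_evalAt (s : ringedSpace A) : toStalk s ≫ evalAt s = toLocAt s := by
  ext a
  exact evalAt_germ s ⊤ trivial (globalSection A a)

theorem globalSection_res (V : Opens (ringedSpace A)) {n : ℕ} (a : (fracLevel A n).idx)
    (hV : ∀ s : V, ∃ h, Extends (toLoc (A := A) s.1) n a h) :
    fracι A n a ≫ fracSection V a hV =
      globalSection A ≫ (ringedSpace A).presheaf.map (homOfLE le_top).op := by
  ext b
  refine Subtype.ext (funext fun s => ?_)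
  exact hom_congr (hV s).choose_spec.fracι_comp b

theorem fracSection_germ (V : Opens (ringedSpace A)) {n : ℕ} (a : (fracLevel A n).idx)
    (hV : ∀ s : V, ∃ h, Extends (toLoc (A := A) s.1) n a h) (s : ringedSpace A) (hs : s ∈ V) :
    fracι A n a ≫ fracSection V a hV ≫ germ (ringedSpace A) V s hs = toStalk s := by
  rw [← Category.assoc, globalSection_res, Category.assoc]
  exact congrArg (fun k => globalSection A ≫ k)
    ((ringedSpace A).presheaf.germ_res (homOfLE le_top) s hs)

/-- A section with invertible value at `s` is invertible near `s`, because its numerator can be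
adjoined to the fraction. -/
theorem isLocalHom_evalAt (s : ringedSpace A) : IsLocalHom (evalAt s).hom := by
  refine ⟨fun z hz => ?_⟩
  obtain ⟨U, hU, t, rfl⟩ := TopCat.Presheaf.exists_germ_eq (structurePresheaf A) z
  exact isUnit_germ s U hU t ((congrArg IsUnit (stalkEval_germ s U hU t)).mp hz)

theorem nontrivial_stalk (s : ringedSpace A) :
    Nontrivial ((ringedSpace A).presheaf.stalk s) :=
  haveI := nontrivial_locAt s
  (evalAt s).hom.domain_nontrivial

/-- A section which is given by a fraction near `s` has the germ given by that fraction. -/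
theorem germ_eq_of_fraction (U : Opens (ringedSpace A))
    (t : (ringedSpace A).presheaf.obj (op U)) (s : ringedSpace A)
    (hs : s ∈ U) :
    ∃ (V : Opens (ringedSpace A)) (_ : s ∈ V) (_ : V ≤ U) (n : ℕ) (a : (fracLevel A n).idx)
      (b : (fracLevel A n).ring a) (hV : ∀ s : V, ∃ h, Extends (toLoc (A := A) s.1) n a h),
      ∀ (x : ringedSpace A) (hx : x ∈ V) (hU : x ∈ U), germ (ringedSpace A) U x hU t =
        germ (ringedSpace A) V x hx (fracSection V a hV b) := by
  obtain ⟨V, hV, i, n, a, b, H⟩ := t.2 ⟨s, hs⟩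
  refine ⟨V, hV, i.le, n, a, b, fun x => ⟨_, (H x).choose_spec.1⟩, fun x hx hU => ?_⟩
  refine (germ_res_apply (X := ringedSpace A) i x hx t).symm.trans (congrArg _ ?_)
  refine Subtype.ext (funext fun y => ?_)
  obtain ⟨h, e, hb⟩ := H y
  refine hb.trans ?_
  exact hom_congr (e.unique (Exists.choose_spec (⟨_, (H y).choose_spec.1⟩ :
    ∃ h, Extends (toLoc (A := A) y.1) n a h))) b

/-- The stalk of `F(A)` at `s` is `A_s`. Evaluation is local, so `A → stalk` has system `s` and
factors through `A_s`. The factorization inverts evaluation: germs are given by fractions, and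
homomorphisms out of `A_a` are determined on `A`. -/
instance isIso_evalAt (s : ringedSpace A) : IsIso (evalAt s) := by
  have hn := nontrivial_stalk s
  have hs : ofHom (toStalk s) hn = s := by
    rw [← ofHom_comp_local (toStalk s) (evalAt s) hn (nontrivial_locAt s)
      (isLocalHom_evalAt s)]
    refine Eq.trans ?_ (ofHom_toLoc (A := A) s)
    congr 1
    exact toStalk_evalAt s
  obtain ⟨ψ, hψ⟩ : ∃ ψ : locAt s ⟶ (ringedSpace A).presheaf.stalk s,
      toLocAt s ≫ ψ = toStalk s :=
    (exists_descOf (A := A) s (toStalk s) hn hs).imp fun _ h => h.1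
  refine ⟨ψ, ?_, ?_⟩
  · refine RingCat.hom_ext (RingHom.ext fun z => ?_)
    obtain ⟨U, hU, t, rfl⟩ := TopCat.Presheaf.exists_germ_eq (ringedSpace A).presheaf z
    obtain ⟨V, hV, i, n, a, b, hVa, e⟩ := germ_eq_of_fraction U t s hU
    have e' := e s hV hU
    have key : fracSection V a hVa ≫ germ (ringedSpace A) V s hV ≫ evalAt s ≫ ψ =
        fracSection V a hVa ≫ germ (ringedSpace A) V s hV := by
      refine frac_hom_ext ?_
      rw [fracSection_germ]
      have := congrArg (fun k => k ≫ evalAt s ≫ ψ) (fracSection_germ V a hVa s hV)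
      simp only [Category.assoc] at this
      rw [this, ← Category.assoc, toStalk_evalAt, hψ]
    have := hom_congr key b
    exact (congrArg (evalAt s ≫ ψ) e').trans (this.trans e'.symm)
  · refine locAt_hom_ext ?_
    have e := congrArg (fun k => k ≫ evalAt s) hψ
    exact (Category.assoc _ _ _).symm.trans (e.trans ((toStalk_evalAt s).trans
      (Category.comp_id _).symm))

theorem isLocalHom_inv_evalAt (s : ringedSpace A) : IsLocalHom (inv (evalAt s)).hom :=
  isLocalHom_iso _

theorem toLocAt_inv_evalAt (s : ringedSpace A) :
    toLocAt s ≫ inv (evalAt s) = toStalk s := by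
  rw [IsIso.comp_inv_eq, toStalk_evalAt]

theorem stalk_hom_ext {s : ringedSpace A} {f g : (ringedSpace A).presheaf.stalk s ⟶ B}
    (h : toStalk s ≫ f = toStalk s ≫ g) : f = g := by
  rw [← cancel_epi (inv (evalAt s))]
  refine locAt_hom_ext ?_
  rwa [← Category.assoc, ← Category.assoc, toLocAt_inv_evalAt]

/-- A local homomorphism from a stalk determines the point. -/
theorem eq_of_stalk_local {s s' : ringedSpace A} (hB : Nontrivial B)
    (f : (ringedSpace A).presheaf.stalk s ⟶ B) (f' : (ringedSpace A).presheaf.stalk s' ⟶ B)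
    (hf : IsLocalHom f.hom) (hf' : IsLocalHom f'.hom) (h : toStalk s ≫ f = toStalk s' ≫ f') :
    s = s' := by
  refine eq_of_local (A := A) s s' (inv (evalAt s) ≫ f :) (inv (evalAt s') ≫ f' :)
    (isLocalHom_comp (inv (evalAt s)) _ (isLocalHom_inv_evalAt s) hf)
    (isLocalHom_comp (inv (evalAt s')) _ (isLocalHom_inv_evalAt s') hf') hB ?_
  change toLocAt s ≫ inv (evalAt s) ≫ f = toLocAt s' ≫ inv (evalAt s') ≫ f'
  rwa [← Category.assoc, ← Category.assoc, toLocAt_inv_evalAt, toLocAt_inv_evalAt]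

/-- The equality of points is a hypothesis, so homomorphisms from the stalks at `s` and at `s'` can
be compared without transport. -/
theorem map_germ_congr {s s' : ringedSpace A} (e : s = s')
    (f : (ringedSpace A).presheaf.stalk s ⟶ B) (f' : (ringedSpace A).presheaf.stalk s' ⟶ B)
    (h : toStalk s ≫ f = toStalk s' ≫ f') (U : Opens (ringedSpace A)) (hs : s ∈ U) (hs' : s' ∈ U)
    (t : (ringedSpace A).presheaf.obj (op U)) :
    f (germ (ringedSpace A) U s hs t) = f' (germ (ringedSpace A) U s' hs' t) := by
  subst e
  rw [stalk_hom_ext h]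

/-! ### Representability: morphisms to `F(R)` are homomorphisms from `R` to global sections -/

/-- `F(A)` as a ringed space with nonzero stalks. -/
noncomputable abbrev locSpace (A : RingCat.{u}) : LocSpace.{u} where
  toSheafedSpace := ringedSpace A
  nontrivial_stalk := nontrivial_stalk

/-- The ring of global sections. -/
noncomputable abbrev Γ (T : LocSpace.{u}) : RingCat.{u} := T.presheaf.obj (op ⊤)

/-- The homomorphism `R → Γ(T)` given by a morphism `T → F(R)`. -/
noncomputable def toΓ {T : LocSpace.{u}} {R : RingCat.{u}} (f : T ⟶ locSpace R) : R ⟶ Γ T :=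
  globalSection R ≫ f.toRingedSpaceHom.hom.c.app (op ⊤)

theorem toΓ_germ {T : LocSpace.{u}} {R : RingCat.{u}} (f : T ⟶ locSpace R)
    (t : T.toSheafedSpace) :
    toΓ f ≫ germ T.toSheafedSpace ⊤ t trivial = toStalk (LocSpace.pt f t) ≫ LocSpace.stalkMap f t := by
  ext r
  exact (RingedSp.stalkMap_germ f.toRingedSpaceHom ⊤ t trivial (globalSection R r)).symm

/-- The homomorphism on `R` determines each composite `R → O_{F(R),f(t)} → O_{T,t}`. Its second
factor is local, so the composite determines the point, and then the stalk homomorphism since `R →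
R_s` is an epimorphism. -/
theorem toΓ_injective {T : LocSpace.{u}} {R : RingCat.{u}} {f g : T ⟶ locSpace R}
    (h : toΓ f = toΓ g) : f = g := by
  have key : ∀ t : T.toSheafedSpace, toStalk (LocSpace.pt f t) ≫ LocSpace.stalkMap f t =
      toStalk (LocSpace.pt g t) ≫ LocSpace.stalkMap g t := fun t => by
    rw [← toΓ_germ, ← toΓ_germ, h]
  have hb : ∀ t : T.toSheafedSpace, LocSpace.pt f t = LocSpace.pt g t := fun t =>
    eq_of_stalk_local (T.nontrivial_stalk t) _ _ (f.isLocal t) (g.isLocal t) (key t)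
  exact LocSpace.hom_ext (RingedSp.hom_ext hb fun U s t hf hg =>
    map_germ_congr (hb t) _ _ (key t) U hf hg s)

/-- Membership in `D(a)` may be tested in any ring representing the system, since extensions descend
along local homomorphisms. -/
theorem ofHom_mem_basicOpen (φ : A ⟶ B) (hB : Nontrivial B) {n : ℕ} (a : (fracLevel A n).idx) :
    ofHom φ hB ∈ basicOpen a ↔ ∃ h, Extends φ n a h := by
  constructor
  · rintro ⟨h, e⟩
    have := e.comp (desc φ hB)
    rw [toLoc_desc] at this
    exact ⟨_, this⟩
  · rintro ⟨h, e⟩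
    rw [← toLoc_desc φ hB] at e
    exact e.descend _ (isLocalHom_desc φ hB)

/-- The point `t` is sent to the system of `R → Γ(T) → O_{T,t}`, and the stalk homomorphism at `t`
is the canonical extension to the localization. -/
theorem exists_toΓ {T : LocSpace.{u}} {R : RingCat.{u}} (φ : R ⟶ Γ T) :
    ∃ f : T ⟶ locSpace R, toΓ f = φ := by
  let φt : ∀ t : T.toSheafedSpace, R ⟶ T.presheaf.stalk t := fun t =>
    φ ≫ germ T.toSheafedSpace ⊤ t trivial
  let h : T.toSheafedSpace → ringedSpace R := fun t => ofHom (φt t) (T.nontrivial_stalk t)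
  have hc : Continuous h := by
    refine continuous_generateFrom_iff.2 ?_
    rintro _ ⟨n, a, rfl⟩
    -- The preimage of `D(a)` is the largest open set on which the entries of `a` become invertible.
    obtain ⟨W, i, ψ, hψ, hW⟩ := exists_extends φ n a
    refine (congrArg IsOpen (Set.ext fun t => ?_)).mp W.2
    refine Iff.trans ?_ (ofHom_mem_basicOpen _ _ _).symm
    refine ⟨fun ht => ?_, fun ht => hW t trivial ht⟩
    have e := hψ.comp (germ T.toSheafedSpace W t ht)
    rw [Category.assoc] at e
    have e' : T.presheaf.map i.op ≫ germ T.toSheafedSpace W t ht =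
      germ T.toSheafedSpace ⊤ t trivial := T.presheaf.germ_res i t ht
    rw [e'] at e
    exact ⟨_, e⟩
  let κ : ∀ t : T.toSheafedSpace, (ringedSpace R).presheaf.stalk (h t) ⟶ T.presheaf.stalk t :=
    fun t => stalkEval (h t) ≫ desc (φt t) (T.nontrivial_stalk t)
  have hκ : ∀ t, toStalk (h t) ≫ κ t = φt t := fun t => by
    have e := congrArg (fun k => k ≫ desc (φt t) (T.nontrivial_stalk t)) (toStalk_evalAt (h t))
    exact (Category.assoc _ _ _).symm.trans (e.trans (toLoc_desc _ _))
  let f : T.toSheafedSpace ⟶ ringedSpace R := homOfStalks (T := T.toSheafedSpace)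
    (Q := ringedSpace R) (TopCat.ofHom ⟨h, hc⟩) κ (by
      intro U s t ht
      obtain ⟨V, hV, j, n, a, b, hVa, e⟩ := germ_eq_of_fraction U s (h t) ht
      obtain ⟨W, i, ψ, hψ, hW⟩ := exists_extends φ n a
      refine ⟨W ⊓ ⟨h ⁻¹' (V : Set (ringedSpace R)), V.2.preimage hc⟩, ⟨hW t trivial ?_, hV⟩,
        T.presheaf.map (Opens.infLELeft _ _).op (ψ b), fun y hy hU => ?_⟩
      · exact (ofHom_mem_basicOpen (φt t) (T.nontrivial_stalk t) a).1 (hVa ⟨h t, hV⟩)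
      · refine Eq.trans ?_ (congrArg (κ y) (e (h y) hy.2 hU)).symm
        refine (germ_res_apply _ y hy _).trans ?_
        -- Near `t` the section is `b ∈ R_a`, whose candidate image is `ψ b`. The two resulting
        -- homomorphisms out of `R_a` agree because they agree on `R`.
        have key : ψ ≫ germ T.toSheafedSpace W y hy.1 =
            fracSection V a hVa ≫ germ (ringedSpace R) V (h y) hy.2 ≫ κ y := by
          refine frac_hom_ext ?_
          have e1 := congrArg (fun k => k ≫ κ y) (fracSection_germ V a hVa (h y) hy.2)
          simp only [Category.assoc] at e1
          rw [e1, hκ, ← Category.assoc, hψ.fracι_comp, Category.assoc]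
          exact congrArg (fun k => φ ≫ k) (T.presheaf.germ_res i y hy.1)
        exact hom_congr key b)
  have hf : ∀ t, f.hom.stalkMap t = κ t := fun t => homOfStalks_stalkMap _ _ _ t
  refine ⟨⟨f, fun t => ?_⟩, ?_⟩
  · refine (congrArg (fun k => IsLocalHom (RingCat.Hom.hom k)) (hf t)).mpr ?_
    exact isLocalHom_comp _ _ (isLocalHom_evalAt _) (isLocalHom_desc _ _)
  · ext r
    refine section_ext (X := T.toSheafedSpace) fun t _ => ?_
    refine (RingedSp.stalkMap_germ f ⊤ t trivial (globalSection R r)).symm.trans ?_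
    exact (hom_congr (hf t) _).trans (hom_congr (hκ t) r)

theorem toΓ_comp {T T' : LocSpace.{u}} {R : RingCat.{u}} (g : T' ⟶ T) (f : T ⟶ locSpace R) :
    toΓ (g ≫ f) = toΓ f ≫ g.toRingedSpaceHom.hom.c.app (op ⊤) := rfl

/-- The morphism `F(B) → F(A)` given by a ring homomorphism. -/
noncomputable def locSpaceMap (χ : A ⟶ B) : locSpace B ⟶ locSpace A :=
  LocSpace.Hom.mk (ringedSpaceMap χ) (isLocalHom_ringedSpaceMap χ)

theorem toΓ_locSpaceMap (χ : A ⟶ B) : toΓ (locSpaceMap χ) = χ ≫ globalSection B := by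
  ext a
  refine Subtype.ext (funext fun s => ?_)
  exact hom_congr (toLoc_pullbackLoc χ s.1) a

theorem toΓ_comp_locSpaceMap {T : LocSpace.{u}} (f : T ⟶ locSpace B) (χ : A ⟶ B) :
    toΓ (f ≫ locSpaceMap χ) = χ ≫ toΓ f := by
  rw [toΓ_comp f (locSpaceMap χ), toΓ_locSpaceMap]
  rfl

/-- `F` turns pushouts of rings into pullbacks. -/
theorem isPullback_locSpaceMap {R A B : RingCat.{u}} (α : R ⟶ A) (β : R ⟶ B) :
    IsPullback (locSpaceMap (Limits.pushout.inl α β)) (locSpaceMap (Limits.pushout.inr α β))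
      (locSpaceMap α) (locSpaceMap β) := by
  -- Under representability a cone over the diagram of spaces is a cocone under the diagram of
  -- rings, so every claim reduces to the universal property of the pushout.
  refine ⟨⟨toΓ_injective ?_⟩, ⟨Limits.PullbackCone.IsLimit.mk _ (fun s => ?_) ?_ ?_ ?_⟩⟩
  · rw [toΓ_comp_locSpaceMap, toΓ_comp_locSpaceMap, toΓ_locSpaceMap, toΓ_locSpaceMap,
      ← Category.assoc, ← Category.assoc, Limits.pushout.condition]
  · exact (exists_toΓ (Limits.pushout.desc (toΓ s.fst) (toΓ s.snd) (by
      rw [← toΓ_comp_locSpaceMap, ← toΓ_comp_locSpaceMap, s.condition]))).choose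
  · intro s
    apply toΓ_injective
    rw [toΓ_comp_locSpaceMap, (exists_toΓ _).choose_spec, Limits.pushout.inl_desc]
  · intro s
    apply toΓ_injective
    rw [toΓ_comp_locSpaceMap, (exists_toΓ _).choose_spec, Limits.pushout.inr_desc]
  · intro s m h1 h2
    apply toΓ_injective
    rw [(exists_toΓ _).choose_spec]
    apply Limits.pushout.hom_ext
    · rw [← toΓ_comp_locSpaceMap, h1, Limits.pushout.inl_desc]
    · rw [← toΓ_comp_locSpaceMap, h2, Limits.pushout.inr_desc]

end FullSpec

namespace FullSpec

open RingedSp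

variable {A B : RingCat.{u}}

/-! ### Global sections and full faithfulness -/

/-- The only open set containing the system of the identity is the whole space. -/
theorem mem_of_isOpen_of_id_mem (hA : Nontrivial A) {U : Set (FullSpec A)} (hU : IsOpen U)
    (h : ofHom (𝟙 A) hA ∈ U) (s : FullSpec A) : s ∈ U := by
  induction hU with
  | basic U hU =>
    obtain ⟨n, a, rfl⟩ := hU
    -- Entries that are successively invertible over `A` itself remain so over every `A_S`.
    obtain ⟨k, e⟩ := (ofHom_mem_basicOpen _ _ _).1 h
    have := e.comp s.toLoc
    rw [Category.id_comp] at this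
    exact ⟨_, this⟩
  | univ => trivial
  | inter U V _ _ h1 h2 => exact ⟨h1 h.1, h2 h.2⟩
  | sUnion S _ ih =>
    obtain ⟨V, hV, hm⟩ := h
    exact ⟨V, hV, ih V hV hm⟩

/-- For `A ≠ 0`, a neighborhood of the system of the identity is everything, so a global section is
given by one fraction. For `A = 0` the space is empty. -/
instance isIso_globalSection (A : RingCat.{u}) : IsIso (globalSection A) := by
  refine (ConcreteCategory.isIso_iff_bijective _).2 ?_
  rcases subsingleton_or_nontrivial A with hA | hA
  · refine ⟨fun _ _ _ => Subsingleton.elim _ _, fun t => ⟨0, Subtype.ext (funext fun s => ?_)⟩⟩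
    have := FullSpec.nontrivial_loc (A := A) s.1
    exact (not_subsingleton_iff_nontrivial.2 (FullSpec.toLoc (A := A) s.1).hom.domain_nontrivial
      hA).elim
  · have hd := toLoc_desc (𝟙 A) hA
    constructor
    · intro a b hab
      have h1 := congrFun (congrArg Subtype.val hab) ⟨ofHom (𝟙 A) hA, trivial⟩
      have h2 := congrArg (desc (𝟙 A) hA) h1
      exact (hom_congr hd a).symm.trans (h2.trans (hom_congr hd b))
    · intro t
      obtain ⟨V, hV, i, n, a, b, H⟩ := t.2 ⟨ofHom (𝟙 A) hA, trivial⟩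
      have hVtop : ∀ s, s ∈ V := mem_of_isOpen_of_id_mem hA V.2 hV
      -- The fraction is defined over the identity of `A`, so it is a genuine element: `k : A_a → A`
      -- retracts `A → A_a`, and `k b` is the preimage sought.
      obtain ⟨k, e⟩ := (ofHom_mem_basicOpen (𝟙 A) hA a).1 ⟨_, (H ⟨_, hV⟩).choose_spec.1⟩
      refine ⟨k b, Subtype.ext (funext fun s => ?_)⟩
      obtain ⟨h, e', hb⟩ := H ⟨s.1, hVtop s.1⟩
      have e2 := e.comp (FullSpec.toLoc (A := A) s.1)
      rw [Category.id_comp] at e2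
      exact (hom_congr (e2.unique e') b).trans hb.symm

theorem existsUnique_locSpaceMap {A R : RingCat.{u}} (f : locSpace A ⟶ locSpace R) :
    ∃! α : R ⟶ A, locSpaceMap α = f := by
  refine ⟨toΓ f ≫ inv (globalSection A), ?_, ?_⟩
  · apply toΓ_injective
    rw [toΓ_locSpaceMap, Category.assoc, IsIso.inv_hom_id, Category.comp_id]
  · rintro α rfl
    rw [toΓ_locSpaceMap, Category.assoc, IsIso.hom_inv_id, Category.comp_id]

theorem locSpaceMap_comp {C : RingCat.{u}} (χ : A ⟶ B) (χ' : B ⟶ C) :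
    locSpaceMap (χ ≫ χ') = locSpaceMap χ' ≫ locSpaceMap χ := by
  apply toΓ_injective
  rw [toΓ_comp_locSpaceMap, toΓ_locSpaceMap, toΓ_locSpaceMap, Category.assoc]

theorem locSpaceMap_id (A : RingCat.{u}) : locSpaceMap (𝟙 A) = 𝟙 (locSpace A) :=
  toΓ_injective ((toΓ_locSpaceMap (𝟙 A)).trans (Category.id_comp _))

end FullSpec

/-! ### Open immersions -/

namespace LocSpace

/-- Open immersions of ringed spaces with nonzero stalks. -/
def IsOpenImm {X Y : LocSpace.{u}} (f : X ⟶ Y) : Prop :=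
  SheafedSpace.IsOpenImmersion f.toRingedSpaceHom

theorem IsOpenImm.isIso_stalkMap {X Y : LocSpace.{u}} {f : X ⟶ Y} (h : IsOpenImm f)
    (x : X.toSheafedSpace) : IsIso (stalkMap f x) :=
  have : SheafedSpace.IsOpenImmersion f.toRingedSpaceHom := h
  SheafedSpace.IsOpenImmersion.stalk_iso f.toRingedSpaceHom x

theorem IsOpenImm.mono {X Y : LocSpace.{u}} {f : X ⟶ Y} (h : IsOpenImm f) : Mono f := by
  have : SheafedSpace.IsOpenImmersion f.toRingedSpaceHom := h
  refine ⟨fun g g' e => hom_ext ?_⟩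
  rw [← cancel_mono f.toRingedSpaceHom]
  exact congrArg Hom.toRingedSpaceHom e

theorem IsOpenImm.comp {X Y Z : LocSpace.{u}} {f : X ⟶ Y} {g : Y ⟶ Z} (hf : IsOpenImm f)
    (hg : IsOpenImm g) : IsOpenImm (f ≫ g) := by
  have : SheafedSpace.IsOpenImmersion f.toRingedSpaceHom := hf
  have : SheafedSpace.IsOpenImmersion g.toRingedSpaceHom := hg
  exact SheafedSpace.IsOpenImmersion.comp f.toRingedSpaceHom g.toRingedSpaceHom

theorem IsOpenImm.of_iso {X Y : LocSpace.{u}} (e : X ≅ Y) : IsOpenImm e.hom := by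
  have : IsIso e.hom.toRingedSpaceHom :=
    ⟨e.inv.toRingedSpaceHom, congrArg Hom.toRingedSpaceHom e.hom_inv_id,
      congrArg Hom.toRingedSpaceHom e.inv_hom_id⟩
  exact SheafedSpace.IsOpenImmersion.of_isIso e.hom.toRingedSpaceHom

theorem IsOpenImm.isOpen_range {X Y : LocSpace.{u}} {f : X ⟶ Y} (h : IsOpenImm f) :
    IsOpen (Set.range (pt f)) :=
  (PresheafedSpace.IsOpenImmersion.base_open (self := h)).isOpen_range

/-- Morphisms lift along open immersions. -/
theorem IsOpenImm.exists_lift {X Y T : LocSpace.{u}} {j : X ⟶ Y} (h : IsOpenImm j) (f : T ⟶ Y)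
    (hf : Set.range (pt f) ⊆ Set.range (pt j)) : ∃ l : T ⟶ X, l ≫ j = f := by
  have : PresheafedSpace.IsOpenImmersion j.toRingedSpaceHom.hom := h
  let l : T.toSheafedSpace ⟶ X.toSheafedSpace := InducedCategory.homMk
    (PresheafedSpace.IsOpenImmersion.lift j.toRingedSpaceHom.hom f.toRingedSpaceHom.hom hf)
  have hl : l ≫ j.toRingedSpaceHom = f.toRingedSpaceHom :=
    InducedCategory.hom_ext (PresheafedSpace.IsOpenImmersion.lift_fac _ _ hf)
  refine ⟨⟨l, isLocal_of_comp l j.toRingedSpaceHom ?_ h.isIso_stalkMap⟩, hom_ext hl⟩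
  rw [hl]
  exact f.isLocal

/-- A ringed space with an open immersion on the level of ringed spaces. -/
def ofOpenImm {X : SheafedSpace RingCat.{u}} {Y : LocSpace.{u}} (j : X ⟶ Y.toSheafedSpace)
    (h : SheafedSpace.IsOpenImmersion j) : LocSpace.{u} where
  toSheafedSpace := X
  nontrivial_stalk x :=
    have := Y.nontrivial_stalk (j.hom.base x)
    have := SheafedSpace.IsOpenImmersion.stalk_iso j x
    (inv (j.hom.stalkMap x)).hom.domain_nontrivial

/-- The open immersion `ofOpenImm j ⟶ Y`. -/
def ofOpenImmHom {X : SheafedSpace RingCat.{u}} {Y : LocSpace.{u}} (j : X ⟶ Y.toSheafedSpace)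
    (h : SheafedSpace.IsOpenImmersion j) : ofOpenImm j h ⟶ Y where
  toRingedSpaceHom := j
  isLocal x :=
    have := SheafedSpace.IsOpenImmersion.stalk_iso j x
    FSchemes.isLocalHom_iso (j.hom.stalkMap x)

/-- The open subspace with a given set of points. -/
noncomputable def restrict (X : LocSpace.{u}) (U : Opens X.toSheafedSpace) : LocSpace.{u} :=
  ofOpenImm (X.toSheafedSpace.ofRestrict U.isOpenEmbedding) inferInstance

/-- The inclusion of an open subspace. -/
noncomputable def restrictι (X : LocSpace.{u}) (U : Opens X.toSheafedSpace) : X.restrict U ⟶ X :=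
  ofOpenImmHom _ _

theorem isOpenImm_restrictι (X : LocSpace.{u}) (U : Opens X.toSheafedSpace) :
    IsOpenImm (X.restrictι U) :=
  inferInstanceAs (SheafedSpace.IsOpenImmersion
    (X.toSheafedSpace.ofRestrict U.isOpenEmbedding))

theorem range_restrictι (X : LocSpace.{u}) (U : Opens X.toSheafedSpace) :
    Set.range (pt (X.restrictι U)) = U := Subtype.range_val

end LocSpace

/-! ### Affine open subspaces -/

namespace FullSpec

open RingedSp LocSpace

variable {A B : RingCat.{u}}

theorem mono_locSpaceMap_fracι {n : ℕ} (a : (fracLevel A n).idx) :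
    Mono (locSpaceMap (fracι A n a)) := by
  refine ⟨fun f g h => toΓ_injective (frac_hom_ext ?_)⟩
  rw [← toΓ_comp_locSpaceMap, ← toΓ_comp_locSpaceMap, h]

/-- The open set `D(a)`. -/
def opensD {n : ℕ} (a : (fracLevel A n).idx) : Opens (locSpace A).toSheafedSpace :=
  ⟨basicOpen a, isOpen_basicOpen a⟩

theorem range_locSpaceMap_fracι_subset {n : ℕ} (a : (fracLevel A n).idx) :
    Set.range (pt (locSpaceMap (fracι A n a))) ⊆ opensD a := by
  rintro _ ⟨s, rfl⟩
  exact (ofHom_mem_basicOpen (fracι A n a ≫ FullSpec.toLoc s)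
    (FullSpec.nontrivial_loc s) a).2
    ⟨_, extends_fracι_comp a (FullSpec.toLoc s)⟩

/-- If `f` lands in `D(a)`, the entries of `a` are invertible at every point of `T`, hence in
`Γ(T)`. With representability, `f` factors through `F(A_a)`. -/
theorem exists_extends_toΓ {T : LocSpace.{u}} (f : T ⟶ locSpace A) {n : ℕ}
    (a : (fracLevel A n).idx) (hf : Set.range (pt f) ⊆ opensD a) :
    ∃ ψ : (fracLevel A n).ring a ⟶ Γ T, Extends (toΓ f) n a ψ := by
  obtain ⟨W, i, ψ, hψ, hW⟩ := exists_extends (toΓ f) n a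
  have hWt : W = ⊤ := by
    refine top_le_iff.1 fun t _ => hW t trivial ?_
    rw [toΓ_germ]
    obtain ⟨h, e⟩ : ∃ h, Extends (toLocAt (pt f t)) n a h := hf ⟨t, rfl⟩
    have := e.comp (inv (evalAt (pt f t)) ≫ stalkMap f t)
    rw [← Category.assoc, toLocAt_inv_evalAt] at this
    exact ⟨_, this⟩
  subst hWt
  have : i = 𝟙 _ := Subsingleton.elim _ _
  rw [this, op_id, T.presheaf.map_id, Category.comp_id] at hψ
  exact ⟨ψ, hψ⟩

/-- `F(A_a) → F(A)` is an open immersion. -/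
theorem isOpenImm_locSpaceMap_fracι {n : ℕ} (a : (fracLevel A n).idx) :
    IsOpenImm (locSpaceMap (fracι A n a)) ∧
      Set.range (pt (locSpaceMap (fracι A n a))) = opensD a := by
  let j := (locSpace A).restrictι (opensD a)
  have hj : IsOpenImm j := isOpenImm_restrictι _ _
  have hr : Set.range (pt j) = opensD a := range_restrictι _ _
  have := hj.mono
  have := mono_locSpaceMap_fracι a
  -- The inclusion of `D(a)` and `F(A_a) → F(A)` are monomorphisms, and each factors through the
  -- other; hence they are isomorphic over `F(A)`.
  obtain ⟨l, hl⟩ := hj.exists_lift (locSpaceMap (fracι A n a)) (by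
    rw [hr]; exact range_locSpaceMap_fracι_subset a)
  obtain ⟨ψ, hψ⟩ := exists_extends_toΓ j a hr.le
  obtain ⟨m, rfl⟩ := exists_toΓ ψ
  have hm : m ≫ locSpaceMap (fracι A n a) = j := toΓ_injective (by
    rw [toΓ_comp_locSpaceMap, hψ.fracι_comp])
  have h1 : l ≫ m = 𝟙 _ := by
    rw [← cancel_mono (locSpaceMap (fracι A n a)), Category.assoc, hm, hl, Category.id_comp]
  have h2 : m ≫ l = 𝟙 _ := by
    rw [← cancel_mono j, Category.assoc, hl, hm, Category.id_comp]
  refine ⟨?_, (range_locSpaceMap_fracι_subset a).antisymm ?_⟩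
  · rw [← hl]
    exact (IsOpenImm.of_iso ⟨l, m, h1, h2⟩).comp hj
  · rw [← hr]
    rintro _ ⟨x, rfl⟩
    exact ⟨pt m x, congrArg (fun k => pt k x) hm⟩

/-- Induction on the generation of the topology. The statement ranges over all `χ : A → B` and `s ∈
F(B)` so that for an intersection the neighborhood found for the first set can be shrunk again for
the second. -/
theorem exists_affine_aux {U : Set (locSpace A).toSheafedSpace} (hU : IsOpen U) :
    ∀ {B : RingCat.{u}} (χ : A ⟶ B) (s : (locSpace B).toSheafedSpace), pt (locSpaceMap χ) s ∈ U →
      ∃ (C : RingCat.{u}) (χ' : B ⟶ C), IsOpenImm (locSpaceMap χ') ∧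
        s ∈ Set.range (pt (locSpaceMap χ')) ∧
        ∀ z, pt (locSpaceMap χ) (pt (locSpaceMap χ') z) ∈ U := by
  induction hU with
  | basic U hU =>
    intro B χ s hs
    obtain ⟨n, a, rfl⟩ := hU
    have e : pullback χ ⁻¹' basicOpen a = basicOpen (pushFrac χ n a).1 := preimage_basicOpen χ a
    obtain ⟨h1, h2⟩ := isOpenImm_locSpaceMap_fracι (pushFrac χ n a).1
    refine ⟨_, _, h1, ?_, fun z => ?_⟩
    · rw [h2]; exact e.subset hs
    · exact e.superset (h2.subset ⟨z, rfl⟩)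
  | univ =>
    intro B χ s _
    exact ⟨B, 𝟙 B, by rw [locSpaceMap_id]; exact IsOpenImm.of_iso (Iso.refl _),
      by rw [locSpaceMap_id]; exact ⟨s, rfl⟩,
      fun _ => trivial⟩
  | inter U V _ _ h1 h2 =>
    intro B χ s hs
    obtain ⟨C, χ', ho, ⟨s', rfl⟩, hU⟩ := h1 χ s hs.1
    have hc := fun z => congrArg (fun k => pt k z) (locSpaceMap_comp χ χ')
    obtain ⟨D, χ'', ho', ⟨s'', rfl⟩, hV⟩ := h2 (χ ≫ χ') s' ((hc s').symm ▸ hs.2)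
    have hc' := fun z => congrArg (fun k => pt k z) (locSpaceMap_comp χ' χ'')
    refine ⟨D, χ' ≫ χ'', ?_, ⟨s'', hc' s''⟩, fun z => ?_⟩
    · rw [locSpaceMap_comp]; exact ho'.comp ho
    · have e : pt (locSpaceMap (χ' ≫ χ'')) z = pt (locSpaceMap χ') (pt (locSpaceMap χ'') z) := hc' z
      rw [e]
      exact ⟨hU _, (hc _) ▸ hV z⟩
  | sUnion S _ ih =>
    rintro B χ s ⟨V, hV, hs⟩
    obtain ⟨C, χ', ho, hr, hU⟩ := ih V hV χ s hs
    exact ⟨C, χ', ho, hr, fun z => ⟨V, hV, hU z⟩⟩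

end FullSpec

namespace LocSpace

/-- A ringed space which is covered by open subspaces of the form `F(A)`. -/
def IsFScheme (X : LocSpace.{u}) : Prop :=
  ∀ x : X.toSheafedSpace, ∃ (A : RingCat.{u}) (j : FullSpec.locSpace A ⟶ X), IsOpenImm j ∧
    x ∈ Set.range (pt j)

/-- The affine open subspaces of an F-scheme form a basis. -/
theorem IsFScheme.exists_affine {X : LocSpace.{u}} (hX : X.IsFScheme) {U : Set X.toSheafedSpace}
    (hU : IsOpen U) {x : X.toSheafedSpace} (hx : x ∈ U) :
    ∃ (A : RingCat.{u}) (j : FullSpec.locSpace A ⟶ X), IsOpenImm j ∧ x ∈ Set.range (pt j) ∧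
      Set.range (pt j) ⊆ U := by
  obtain ⟨A, j, hj, s, rfl⟩ := hX x
  obtain ⟨C, χ, ho, ⟨s', hs'⟩, h⟩ := FullSpec.exists_affine_aux
    (hU.preimage j.toRingedSpaceHom.hom.base.hom.continuous) (𝟙 A) s (by
      rw [FullSpec.locSpaceMap_id]; exact hx)
  rw [FullSpec.locSpaceMap_id] at h
  refine ⟨C, FullSpec.locSpaceMap χ ≫ j, ho.comp hj, ⟨s', congrArg (pt j) hs'⟩, ?_⟩
  rintro _ ⟨z, rfl⟩
  exact h z

end LocSpace

/-! ### The fiber product of ringed spaces with nonzero stalks -/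

namespace LocSpace

open RingedSp

theorem stalkMap_germ_congr {T Y : LocSpace.{u}} {a b : T ⟶ Y} (e : a = b) (t : T.toSheafedSpace)
    (W : Opens Y.toSheafedSpace) (ha : pt a t ∈ W) (hb : pt b t ∈ W)
    (s : Y.presheaf.obj (op W)) :
    stalkMap a t (germ Y.toSheafedSpace W _ ha s) = stalkMap b t (germ Y.toSheafedSpace W _ hb s) := by
  subst e; rfl

section FiberProduct

variable {X Y Z : LocSpace.{u}} (f : X ⟶ Y) (g : Z ⟶ Y)

/-- The second homomorphism `O_{Y,f(x)} → O_{Z,z}` for `f(x) = g(z)`. -/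
noncomputable def stalkMapOfEq {x : X.toSheafedSpace} {z : Z.toSheafedSpace}
    (h : pt f x = pt g z) : Y.presheaf.stalk (pt f x) ⟶ Z.presheaf.stalk z :=
  Y.presheaf.stalkSpecializes (specializes_of_eq h.symm) ≫ stalkMap g z

theorem stalkMapOfEq_germ {x : X.toSheafedSpace} {z : Z.toSheafedSpace} (h : pt f x = pt g z)
    (W : Opens Y.toSheafedSpace) (hx : pt f x ∈ W) (hz : pt g z ∈ W)
    (s : Y.presheaf.obj (op W)) :
    stalkMapOfEq f g h (germ Y.toSheafedSpace W _ hx s) =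
      stalkMap g z (germ Y.toSheafedSpace W _ hz s) :=
  congrArg (stalkMap g z)
    (hom_congr (Y.presheaf.germ_stalkSpecializes hx (specializes_of_eq h.symm)) s)

/-- The coproduct of the stalks at `x` and `z` over the stalk at `f(x) = g(z)`. -/
noncomputable abbrev stalkPushout {x : X.toSheafedSpace} {z : Z.toSheafedSpace}
    (h : pt f x = pt g z) : RingCat.{u} :=
  Limits.pushout (stalkMap f x) (stalkMapOfEq f g h)

/-- The points of the fiber product. -/
structure FibPt where
  x : X.toSheafedSpace
  z : Z.toSheafedSpace
  h : pt f x = pt g z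
  sys : FullSpec (stalkPushout f g h)
  local_inl : IsLocalHom (Limits.pushout.inl _ _ ≫ sys.toLoc).hom
  local_inr : IsLocalHom (Limits.pushout.inr _ _ ≫ sys.toLoc).hom

namespace FibPt

variable {f g}
variable (p : FibPt f g)

/-- The ring attached to a point of the fiber product. -/
noncomputable abbrev loc : RingCat.{u} := p.sys.loc

/-- The homomorphism from the stalk of the first factor. -/
noncomputable def inl : X.presheaf.stalk p.x ⟶ p.loc := Limits.pushout.inl _ _ ≫ p.sys.toLoc

/-- The homomorphism from the stalk of the second factor. -/
noncomputable def inr : Z.presheaf.stalk p.z ⟶ p.loc := Limits.pushout.inr _ _ ≫ p.sys.toLoc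

theorem nontrivial_loc : Nontrivial p.loc := p.sys.nontrivial_loc

theorem condition : stalkMap f p.x ≫ p.inl = stalkMapOfEq f g p.h ≫ p.inr := by
  rw [inl, inr, ← Category.assoc, ← Category.assoc, Limits.pushout.condition]

theorem condition_germ (W : Opens Y.toSheafedSpace) (hx : pt f p.x ∈ W) (hz : pt g p.z ∈ W)
    (s : Y.presheaf.obj (op W)) :
    p.inl (stalkMap f p.x (germ Y.toSheafedSpace W _ hx s)) =
      p.inr (stalkMap g p.z (germ Y.toSheafedSpace W _ hz s)) := by
  rw [← stalkMapOfEq_germ f g p.h W hx hz s]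
  exact hom_congr p.condition _

-- The localization is an epimorphic image of the pushout, and the pushout is tested on its two
-- factors.
variable {p} in
theorem loc_hom_ext {B : RingCat.{u}} {k k' : p.loc ⟶ B} (h1 : p.inl ≫ k = p.inl ≫ k')
    (h2 : p.inr ≫ k = p.inr ≫ k') : k = k' := by
  refine FullSpec.loc_hom_ext (s := p.sys) (Limits.pushout.hom_ext ?_ ?_)
  · rw [← Category.assoc, ← Category.assoc]; exact h1
  · rw [← Category.assoc, ← Category.assoc]; exact h2

/-- The coproduct of the rings of sections over `U` and `V`. -/
noncomputable abbrev chart (X Z : LocSpace.{u}) (U : Opens X.toSheafedSpace)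
    (V : Opens Z.toSheafedSpace) : RingCat.{u} :=
  Limits.coprod (X.presheaf.obj (op U)) (Z.presheaf.obj (op V))

/-- Evaluation at a point of the fiber product. -/
noncomputable def ev (U : Opens X.toSheafedSpace) (V : Opens Z.toSheafedSpace) (hx : p.x ∈ U)
    (hz : p.z ∈ V) : chart X Z U V ⟶ p.loc :=
  Limits.coprod.desc (germ X.toSheafedSpace U p.x hx ≫ p.inl)
    (germ Z.toSheafedSpace V p.z hz ≫ p.inr)

theorem inl_ev (U : Opens X.toSheafedSpace) (V : Opens Z.toSheafedSpace) (hx : p.x ∈ U)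
    (hz : p.z ∈ V) : Limits.coprod.inl ≫ p.ev U V hx hz =
      germ X.toSheafedSpace U p.x hx ≫ p.inl := Limits.coprod.inl_desc _ _

theorem inr_ev (U : Opens X.toSheafedSpace) (V : Opens Z.toSheafedSpace) (hx : p.x ∈ U)
    (hz : p.z ∈ V) : Limits.coprod.inr ≫ p.ev U V hx hz =
      germ Z.toSheafedSpace V p.z hz ≫ p.inr := Limits.coprod.inr_desc _ _

/-- Restriction homomorphisms of charts. -/
noncomputable def chartRes {U U' : Opens X.toSheafedSpace} {V V' : Opens Z.toSheafedSpace}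
    (i : U' ⟶ U) (j : V' ⟶ V) : chart X Z U V ⟶ chart X Z U' V' :=
  Limits.coprod.map (X.presheaf.map i.op) (Z.presheaf.map j.op)

theorem chartRes_ev {U U' : Opens X.toSheafedSpace} {V V' : Opens Z.toSheafedSpace}
    (i : U' ⟶ U) (j : V' ⟶ V) (hx : p.x ∈ U') (hz : p.z ∈ V') :
    chartRes i j ≫ p.ev U' V' hx hz = p.ev U V (i.le hx) (j.le hz) := by
  rw [chartRes, ev, ev, Limits.coprod.map_desc, ← Category.assoc, ← Category.assoc]
  congr 2
  · exact X.presheaf.germ_res i _ hx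
  · exact Z.presheaf.germ_res j _ hz

variable (f g) in
/-- The points at which a fraction of a chart is defined. -/
def basicOpen (U : Opens X.toSheafedSpace) (V : Opens Z.toSheafedSpace) {n : ℕ}
    (a : (fracLevel (chart X Z U V) n).idx) : Set (FibPt f g) :=
  {p | ∃ hx hz h, Extends (p.ev U V hx hz) n a h}

instance : TopologicalSpace (FibPt f g) :=
  generateFrom {D | ∃ (U : Opens X.toSheafedSpace) (V : Opens Z.toSheafedSpace) (n : ℕ)
    (a : (fracLevel (chart X Z U V) n).idx), D = basicOpen f g U V a}

theorem isOpen_basicOpen (U : Opens X.toSheafedSpace) (V : Opens Z.toSheafedSpace) {n : ℕ}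
    (a : (fracLevel (chart X Z U V) n).idx) : IsOpen (basicOpen f g U V a) :=
  isOpen_generateFrom_of_mem ⟨U, V, n, a, rfl⟩

variable (f g) in
/-- The topological space of points of the fiber product. -/
def top : TopCat.{u} := TopCat.of (FibPt f g)

/-- Two fractions of charts have a common refinement. -/
theorem exists_chart_refinement {U U' : Opens X.toSheafedSpace} {V V' : Opens Z.toSheafedSpace}
    {n n' : ℕ} (a : (fracLevel (chart X Z U V) n).idx)
    (a' : (fracLevel (chart X Z U' V') n').idx) :
    ∃ (U₁ : Opens X.toSheafedSpace) (V₁ : Opens Z.toSheafedSpace) (k : ℕ)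
      (c : (fracLevel (chart X Z U₁ V₁) k).idx)
      (r : (fracLevel (chart X Z U V) n).ring a ⟶ (fracLevel (chart X Z U₁ V₁) k).ring c)
      (r' : (fracLevel (chart X Z U' V') n').ring a' ⟶ (fracLevel (chart X Z U₁ V₁) k).ring c),
      ∀ (p : FibPt f g) {hx hz hx' hz' h h'}, Extends (p.ev U V hx hz) n a h →
        Extends (p.ev U' V' hx' hz') n' a' h' →
        ∃ hx₁ hz₁ l, Extends (p.ev U₁ V₁ hx₁ hz₁) k c l ∧ r ≫ l = h ∧ r' ≫ l = h' := by
  let χ : chart X Z U V ⟶ chart X Z (U ⊓ U') (V ⊓ V') :=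
    chartRes (Opens.infLELeft _ _) (Opens.infLELeft _ _)
  let χ' : chart X Z U' V' ⟶ chart X Z (U ⊓ U') (V ⊓ V') :=
    chartRes (Opens.infLERight _ _) (Opens.infLERight _ _)
  -- Both fractions are first pushed to the common chart over `U ⊓ U'` and `V ⊓ V'`.
  obtain ⟨k, c, r, r', H⟩ := exists_refinement (pushFrac χ n a).1 (pushFrac χ' n' a').1
  refine ⟨_, _, k, c, (pushFrac χ n a).2 ≫ r, (pushFrac χ' n' a').2 ≫ r', ?_⟩
  intro p hx hz hx' hz' h h' e e'
  have hx₁ : p.x ∈ U ⊓ U' := ⟨hx, hx'⟩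
  have hz₁ : p.z ∈ V ⊓ V' := ⟨hz, hz'⟩
  rw [← p.chartRes_ev (Opens.infLELeft U U') (Opens.infLELeft V V') hx₁ hz₁] at e
  rw [← p.chartRes_ev (Opens.infLERight U U') (Opens.infLERight V V') hx₁ hz₁] at e'
  obtain ⟨k₁, hk₁⟩ := e.push χ
  obtain ⟨k₂, hk₂⟩ := e'.push χ'
  obtain ⟨l, hl, h1, h2⟩ := H hk₁ hk₂
  refine ⟨hx₁, hz₁, l, hl, ?_, ?_⟩
  · rw [Category.assoc, h1]; exact (hk₁.of_push χ).unique e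
  · rw [Category.assoc, h2]; exact (hk₂.of_push χ').unique e'

variable (f g) in
/-- Families which are given by a single element of a localized chart. -/
def isFraction : TopCat.PrelocalPredicate (X := top f g) (fun p : FibPt f g => p.loc) where
  pred {W} t := ∃ (U : Opens X.toSheafedSpace) (V : Opens Z.toSheafedSpace) (n : ℕ)
    (a : (fracLevel (chart X Z U V) n).idx) (b : (fracLevel (chart X Z U V) n).ring a),
    ∀ p : W, ∃ hx hz h, Extends (FibPt.ev (f := f) (g := g) p.1 U V hx hz) n a h ∧ t p = h b
  res := by
    rintro V W i t ⟨U, V, n, a, b, H⟩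
    exact ⟨U, V, n, a, b, fun s => H (i s)⟩

variable (f g) in
/-- Families which are locally given by fractions. -/
def isLocallyFraction : TopCat.LocalPredicate (X := top f g) (fun p : FibPt f g => p.loc) :=
  (isFraction f g).sheafify

theorem isLocallyFraction_of_chart {W : Opens (top f g)}
    {t : ∀ p : W, FibPt.loc (f := f) (g := g) p.1} (U : Opens X.toSheafedSpace)
    (V : Opens Z.toSheafedSpace) (c : chart X Z U V)
    (H : ∀ p : W, ∃ hx hz, t p = FibPt.ev (f := f) (g := g) p.1 U V hx hz c) :
    (isLocallyFraction f g).pred t := fun p =>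
  ⟨W, p.2, 𝟙 _, U, V, 0, PUnit.unit, c, fun q => by
    obtain ⟨hx, hz, e⟩ := H q
    exact ⟨hx, hz, _, rfl, e⟩⟩

/-- Any binary operation natural in the ring is computed on a common refinement. This serves
addition, multiplication and, ignoring the second argument, negation. -/
theorem isLocallyFraction_op₂ {W : Opens (top f g)}
    {t t' : ∀ p : W, FibPt.loc (f := f) (g := g) p.1} (ht : (isLocallyFraction f g).pred t)
    (ht' : (isLocallyFraction f g).pred t') (o : ∀ (R : RingCat.{u}), R → R → R)
    (ho : ∀ {R R' : RingCat.{u}} (k : R ⟶ R') (a b : R), o R' (k a) (k b) = k (o R a b)) :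
    (isLocallyFraction f g).pred (fun p => o _ (t p) (t' p)) := fun p => by
  obtain ⟨W₁, hW₁, i, U, V, n, a, b, H⟩ := ht p
  obtain ⟨W₂, hW₂, i', U', V', n', a', b', H'⟩ := ht' p
  obtain ⟨U₁, V₁, k, c, r, r', R⟩ := exists_chart_refinement (f := f) (g := g) a a'
  refine ⟨W₁ ⊓ W₂, ⟨hW₁, hW₂⟩, Opens.infLELeft _ _ ≫ i, U₁, V₁, k, c, o _ (r b) (r' b'),
    fun q => ?_⟩
  obtain ⟨hx, hz, h, e, hb⟩ := H ⟨q.1, q.2.1⟩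
  obtain ⟨hx', hz', h', e', hb'⟩ := H' ⟨q.1, q.2.2⟩
  obtain ⟨hx₁, hz₁, l, hl, rfl, rfl⟩ := R q.1 e e'
  exact ⟨hx₁, hz₁, l, hl, (congrArg₂ (o _) hb hb').trans (ho l (r b) (r' b'))⟩

variable (f g) in
/-- The ring of sections of the fiber product. -/
def sections (W : Opens (top f g)) :
    Subring (∀ p : W, FibPt.loc (f := f) (g := g) p.1) where
  carrier := {t | (isLocallyFraction f g).pred t}
  zero_mem' := isLocallyFraction_of_chart ⊤ ⊤ 0 fun _ => ⟨trivial, trivial, (map_zero _).symm⟩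
  one_mem' := isLocallyFraction_of_chart ⊤ ⊤ 1 fun _ => ⟨trivial, trivial, (map_one _).symm⟩
  neg_mem' ht := isLocallyFraction_op₂ ht ht (fun _ a _ => -a)
    fun k a _ => (map_neg k.hom a).symm
  add_mem' ht ht' := isLocallyFraction_op₂ ht ht' (fun _ a b => a + b)
    fun k a b => (map_add k.hom a b).symm
  mul_mem' ht ht' := isLocallyFraction_op₂ ht ht' (fun _ a b => a * b)
    fun k a b => (map_mul k.hom a b).symm

variable (f g) in
/-- The structure sheaf of the fiber product as a presheaf. -/
noncomputable def structurePresheaf : TopCat.Presheaf RingCat.{u} (top f g) where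
  obj W := RingCat.of (sections f g W.unop)
  map {_ _} i := RingCat.ofHom
    { toFun := fun t => ⟨fun p => t.1 (i.unop p), (isLocallyFraction f g).res i.unop t.1 t.2⟩
      map_one' := rfl
      map_mul' := fun _ _ => rfl
      map_zero' := rfl
      map_add' := fun _ _ => rfl }

variable (f g) in
theorem isSheaf_structurePresheaf : (structurePresheaf f g).IsSheaf :=
  (TopCat.Presheaf.isSheaf_iff_isSheaf_comp (forget RingCat) _).2
    (TopCat.Presheaf.isSheaf_of_iso
      (NatIso.ofComponents fun _ => Iso.refl _)
      (TopCat.subsheafToTypes (isLocallyFraction f g)).property)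

end FibPt

open FibPt

/-- The fiber product as a ringed space. -/
noncomputable abbrev fib : SheafedSpace RingCat.{u} where
  carrier := FibPt.top f g
  presheaf := structurePresheaf f g
  IsSheaf := isSheaf_structurePresheaf f g

end FiberProduct

end LocSpace

/-! ### Projections and stalks of the fiber product -/

namespace LocSpace

open RingedSp FibPt

section FiberProduct

variable {X Y Z : LocSpace.{u}} (f : X ⟶ Y) (g : Z ⟶ Y)

/-- The first projection on points. -/
noncomputable def fibFstBase : FibPt.top f g ⟶ (X.toSheafedSpace : TopCat.{u}) :=
  TopCat.ofHom ⟨FibPt.x, ⟨fun U hU => by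
    -- The preimage of `U` is the basic open set of the empty fraction (length 0) on the chart `(U,
    -- ⊤)`.
    refine (congrArg IsOpen (Set.ext fun p => ?_)).mp
      (isOpen_basicOpen (f := f) (g := g) ⟨U, hU⟩ ⊤ (n := 0) PUnit.unit)
    exact ⟨fun h => h.1, fun h => ⟨h, trivial, _, rfl⟩⟩⟩⟩

/-- The first projection on sections. -/
noncomputable def fibFstSections (U : Opens X.toSheafedSpace) :
    X.presheaf.obj (op U) →+* sections f g ((Opens.map (fibFstBase f g)).obj U) where
  toFun s := ⟨fun p => FibPt.inl (f := f) (g := g) p.1 (germ X.toSheafedSpace U _ p.2 s), by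
    refine isLocallyFraction_of_chart (W := (Opens.map (fibFstBase f g)).obj U)
      (t := fun p => FibPt.inl (f := f) (g := g) p.1 (germ X.toSheafedSpace U _ p.2 s))
      U ⊤ ((Limits.coprod.inl : _ ⟶ chart X Z U ⊤) s)
      fun p => ⟨p.2, trivial, ?_⟩
    have h := Limits.coprod.inl_desc (germ X.toSheafedSpace U p.1.x p.2 ≫ p.1.inl)
      (germ Z.toSheafedSpace ⊤ p.1.z trivial ≫ p.1.inr)
    exact (hom_congr h s).symm⟩
  map_one' := Subtype.ext (funext fun p =>
    map_one (germ X.toSheafedSpace U _ p.2 ≫ FibPt.inl (f := f) (g := g) p.1).hom)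
  map_mul' _ _ := Subtype.ext (funext fun p =>
    map_mul (germ X.toSheafedSpace U _ p.2 ≫ FibPt.inl (f := f) (g := g) p.1).hom _ _)
  map_zero' := Subtype.ext (funext fun p =>
    map_zero (germ X.toSheafedSpace U _ p.2 ≫ FibPt.inl (f := f) (g := g) p.1).hom)
  map_add' _ _ := Subtype.ext (funext fun p =>
    map_add (germ X.toSheafedSpace U _ p.2 ≫ FibPt.inl (f := f) (g := g) p.1).hom _ _)

/-- The first projection. -/
noncomputable def fibFst : fib f g ⟶ X.toSheafedSpace :=
  InducedCategory.homMk
    { base := fibFstBase f g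
      c :=
        { app := fun U => RingCat.ofHom (fibFstSections f g U.unop)
          naturality := fun _ _ i => RingCat.hom_ext (RingHom.ext fun s =>
            Subtype.ext (funext fun p => congrArg (FibPt.inl (f := f) (g := g) p.1)
              (germ_res_apply (X := X.toSheafedSpace) i.unop _ p.2 s))) } }

/-- The second projection on points. -/
noncomputable def fibSndBase : FibPt.top f g ⟶ (Z.toSheafedSpace : TopCat.{u}) :=
  TopCat.ofHom ⟨FibPt.z, ⟨fun U hU => by
    refine (congrArg IsOpen (Set.ext fun p => ?_)).mp
      (isOpen_basicOpen (f := f) (g := g) ⊤ ⟨U, hU⟩ (n := 0) PUnit.unit)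
    exact ⟨fun h => h.2.1, fun h => ⟨trivial, h, _, rfl⟩⟩⟩⟩

/-- The second projection on sections. -/
noncomputable def fibSndSections (U : Opens Z.toSheafedSpace) :
    Z.presheaf.obj (op U) →+* sections f g ((Opens.map (fibSndBase f g)).obj U) where
  toFun s := ⟨fun p => FibPt.inr (f := f) (g := g) p.1 (germ Z.toSheafedSpace U _ p.2 s), by
    refine isLocallyFraction_of_chart (W := (Opens.map (fibSndBase f g)).obj U)
      (t := fun p => FibPt.inr (f := f) (g := g) p.1 (germ Z.toSheafedSpace U _ p.2 s))
      ⊤ U ((Limits.coprod.inr : _ ⟶ chart X Z ⊤ U) s)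
      fun p => ⟨trivial, p.2, ?_⟩
    have h := Limits.coprod.inr_desc (germ X.toSheafedSpace ⊤ p.1.x trivial ≫ p.1.inl)
      (germ Z.toSheafedSpace U p.1.z p.2 ≫ p.1.inr)
    exact (hom_congr h s).symm⟩
  map_one' := Subtype.ext (funext fun p =>
    map_one (germ Z.toSheafedSpace U _ p.2 ≫ FibPt.inr (f := f) (g := g) p.1).hom)
  map_mul' _ _ := Subtype.ext (funext fun p =>
    map_mul (germ Z.toSheafedSpace U _ p.2 ≫ FibPt.inr (f := f) (g := g) p.1).hom _ _)
  map_zero' := Subtype.ext (funext fun p =>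
    map_zero (germ Z.toSheafedSpace U _ p.2 ≫ FibPt.inr (f := f) (g := g) p.1).hom)
  map_add' _ _ := Subtype.ext (funext fun p =>
    map_add (germ Z.toSheafedSpace U _ p.2 ≫ FibPt.inr (f := f) (g := g) p.1).hom _ _)

/-- The second projection. -/
noncomputable def fibSnd : fib f g ⟶ Z.toSheafedSpace :=
  InducedCategory.homMk
    { base := fibSndBase f g
      c :=
        { app := fun U => RingCat.ofHom (fibSndSections f g U.unop)
          naturality := fun _ _ i => RingCat.hom_ext (RingHom.ext fun s =>
            Subtype.ext (funext fun p => congrArg (FibPt.inr (f := f) (g := g) p.1)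
              (germ_res_apply (X := Z.toSheafedSpace) i.unop _ p.2 s))) } }

namespace FibPt

variable {f g}

/-- Evaluation of germs at a point of the fiber product. -/
noncomputable def evalTop (p : FibPt.top f g) :
    (fib f g).presheaf.stalk p ⟶ FibPt.loc (f := f) (g := g) p :=
  Limits.colimit.desc ((OpenNhds.inclusion p).op ⋙ structurePresheaf f g)
    { pt := FibPt.loc (f := f) (g := g) p
      ι := { app := fun U => RingCat.ofHom
               ((Pi.evalRingHom _ (⟨p, U.unop.2⟩ : U.unop.1)).comp (sections f g U.unop.1).subtype)
             naturality := fun _ _ _ => rfl } }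

theorem eval_germ_top (p : FibPt.top f g) (W : Opens (FibPt.top f g)) (hp : p ∈ W)
    (t : sections f g W) : evalTop p ((structurePresheaf f g).germ W p hp t) = t.1 ⟨p, hp⟩ := by
  have h : (structurePresheaf f g).germ W p hp ≫ evalTop p = RingCat.ofHom
      ((Pi.evalRingHom _ (⟨p, hp⟩ : W)).comp (sections f g W).subtype) :=
    Limits.colimit.ι_desc (F := (OpenNhds.inclusion p).op ⋙ structurePresheaf f g) _
      (op (⟨W, hp⟩ : OpenNhds p))
  exact hom_congr h t

/-- Evaluation of germs at a point of the fiber product. -/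
noncomputable def eval (p : FibPt f g) : (fib f g).presheaf.stalk p ⟶ p.loc := evalTop p

theorem eval_germ (p : FibPt f g) (W : Opens (fib f g)) (hp : p ∈ W) (t : sections f g W) :
    p.eval (germ (fib f g) W p hp t) = t.1 ⟨p, hp⟩ :=
  eval_germ_top p W hp t

theorem nontrivial_stalk (p : FibPt f g) : Nontrivial ((fib f g).presheaf.stalk p) :=
  have := p.nontrivial_loc
  p.eval.hom.domain_nontrivial

/-- The homomorphism from a localized chart to the sections over an open set on which the fraction
is defined. -/
noncomputable def fracSection (W : Opens (fib f g)) {U : Opens X.toSheafedSpace}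
    {V : Opens Z.toSheafedSpace} {n : ℕ} (a : (fracLevel (chart X Z U V) n).idx)
    (hW : ∀ p : W, ∃ hx hz h, Extends (p.1.ev U V hx hz) n a h) :
    (fracLevel (chart X Z U V) n).ring a ⟶ (fib f g).presheaf.obj (op W) :=
  RingCat.ofHom
    { toFun := fun b => (⟨fun p => (hW p).choose_spec.choose_spec.choose b, fun p =>
        ⟨W, p.2, 𝟙 _, U, V, n, a, b, fun q => ⟨_, _, _,
          (hW q).choose_spec.choose_spec.choose_spec, rfl⟩⟩⟩ : sections f g W)
      map_one' := Subtype.ext (funext fun p => map_one (hW p).choose_spec.choose_spec.choose.hom)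
      map_mul' := fun _ _ => Subtype.ext (funext fun p =>
        map_mul (hW p).choose_spec.choose_spec.choose.hom _ _)
      map_zero' := Subtype.ext (funext fun p => map_zero (hW p).choose_spec.choose_spec.choose.hom)
      map_add' := fun _ _ => Subtype.ext (funext fun p =>
        map_add (hW p).choose_spec.choose_spec.choose.hom _ _) }

theorem fracSection_val (W : Opens (fib f g)) {U : Opens X.toSheafedSpace}
    {V : Opens Z.toSheafedSpace} {n : ℕ} (a : (fracLevel (chart X Z U V) n).idx)
    (hW : ∀ p : W, ∃ hx hz h, Extends (p.1.ev U V hx hz) n a h)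
    (b : (fracLevel (chart X Z U V) n).ring a) (p : W) {hx hz h}
    (e : Extends (p.1.ev U V hx hz) n a h) :
    (fracSection W a hW b : sections f g W).1 p = h b :=
  hom_congr ((hW p).choose_spec.choose_spec.choose_spec.unique e) b

/-- A section which is given by a fraction near `p` has the germs given by that fraction. -/
theorem germ_eq_of_fraction (W : Opens (fib f g)) (t : (fib f g).presheaf.obj (op W))
    (p : FibPt f g) (hp : p ∈ W) :
    ∃ (D : Opens (fib f g)) (_ : p ∈ D) (_ : D ≤ W) (U : Opens X.toSheafedSpace)
      (V : Opens Z.toSheafedSpace) (n : ℕ) (a : (fracLevel (chart X Z U V) n).idx)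
      (b : (fracLevel (chart X Z U V) n).ring a)
      (hD : ∀ p : D, ∃ hx hz h, Extends (p.1.ev U V hx hz) n a h),
      ∀ (q : FibPt f g) (hq : q ∈ D) (hW : q ∈ W), germ (fib f g) W q hW t =
        germ (fib f g) D q hq (fracSection D a hD b) := by
  obtain ⟨D, hD, i, U, V, n, a, b, H⟩ := (t : sections f g W).2 ⟨p, hp⟩
  have hD' : ∀ p : D, ∃ hx hz h, Extends (p.1.ev U V hx hz) n a h := fun q => by
    obtain ⟨hx, hz, h, e, -⟩ := H q
    exact ⟨hx, hz, h, e⟩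
  refine ⟨D, hD, i.le, U, V, n, a, b, hD', fun q hq hW => ?_⟩
  refine (germ_res_apply (X := fib f g) i q hq t).symm.trans (congrArg _ ?_)
  refine Subtype.ext (funext fun y => ?_)
  obtain ⟨hx, hz, h, e, hb⟩ := H y
  exact hb.trans (fracSection_val D a hD' b y e).symm

/-- A section given by `b` over the fraction `a`, with unit value at `p`, is invertible on the
neighborhood of `p` where the longer fraction `(a, b)` is defined. -/
theorem isLocalHom_eval (p : FibPt f g) : IsLocalHom p.eval.hom := by
  refine ⟨fun z hz => ?_⟩
  obtain ⟨W, hW, t, rfl⟩ := TopCat.Presheaf.exists_germ_eq (fib f g).presheaf z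
  obtain ⟨D, hD, -, U, V, n, a, b, hDa, e⟩ := germ_eq_of_fraction W t p hW
  have e' := e p hD hW
  obtain ⟨hx, hz', h, he⟩ := hDa ⟨p, hD⟩
  have hu : IsUnit (h b) := by
    have h1 : p.eval (germ (fib f g) W p hW t) = h b :=
      (congrArg p.eval e').trans ((eval_germ p D hD _).trans
        (fracSection_val D a hDa b ⟨p, hD⟩ he))
    exact h1 ▸ hz
  obtain ⟨l, hl, -⟩ := he.succ b hu
  let D' : Opens (fib f g) := D ⊓ ⟨basicOpen f g U V (n := n + 1) ⟨a, b⟩, isOpen_basicOpen _ _ _⟩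
  have hD' : p ∈ D' := ⟨hD, hx, hz', l, hl⟩
  have hDb : ∀ p : D', ∃ hx hz h, Extends (p.1.ev U V hx hz) (n + 1) ⟨a, b⟩ h := fun q => q.2.2
  have key : (fib f g).presheaf.map (Opens.infLELeft _ _ : D' ⟶ D).op (fracSection D a hDa b) =
      fracSection D' (n := n + 1) ⟨a, b⟩ hDb (Loc.ι _ {b} b) := by
    refine Subtype.ext (funext fun q => ?_)
    obtain ⟨hx, hz, k, g', hg, hu, w⟩ := hDb q
    have h1 := fracSection_val D a hDa b ⟨q.1, q.2.1⟩ hg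
    have h2 := fracSection_val D' (n := n + 1) ⟨a, b⟩ hDb (Loc.ι _ {b} b) q ⟨g', hg, hu, w⟩
    exact h1.trans ((hom_congr w b).symm.trans h2.symm)
  refine (congrArg IsUnit e').mpr ?_
  refine (congrArg IsUnit (germ_res_apply (X := fib f g) (Opens.infLELeft _ _ : D' ⟶ D) p hD'
    (fracSection D a hDa b))).mp ?_
  rw [key]
  exact ((Loc.isUnit_ι (Set.mem_singleton b)).map (fracSection D' (n := n + 1) ⟨a, b⟩ hDb).hom).map
    (germ (fib f g) D' p hD').hom

/-- The homomorphism from the stalk of the first factor to the stalk of the fiber product. -/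
noncomputable def stalkFst (p : FibPt f g) :
    X.presheaf.stalk p.x ⟶ (fib f g).presheaf.stalk p :=
  (fibFst f g).hom.stalkMap p

/-- The homomorphism from the stalk of the second factor to the stalk of the fiber product. -/
noncomputable def stalkSnd (p : FibPt f g) :
    Z.presheaf.stalk p.z ⟶ (fib f g).presheaf.stalk p :=
  (fibSnd f g).hom.stalkMap p

theorem stalkFst_germ (p : FibPt f g) (U : Opens X.toSheafedSpace) (hx : p.x ∈ U)
    (s : X.presheaf.obj (op U)) :
    p.stalkFst (germ X.toSheafedSpace U p.x hx s) = germ (fib f g)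
      ((Opens.map (fibFst f g).hom.base).obj U) p hx ((fibFst f g).hom.c.app (op U) s) :=
  RingedSp.stalkMap_germ (fibFst f g) U p hx s

theorem stalkSnd_germ (p : FibPt f g) (U : Opens Z.toSheafedSpace) (hx : p.z ∈ U)
    (s : Z.presheaf.obj (op U)) :
    p.stalkSnd (germ Z.toSheafedSpace U p.z hx s) = germ (fib f g)
      ((Opens.map (fibSnd f g).hom.base).obj U) p hx ((fibSnd f g).hom.c.app (op U) s) :=
  RingedSp.stalkMap_germ (fibSnd f g) U p hx s

theorem stalkFst_eval (p : FibPt f g) : p.stalkFst ≫ p.eval = p.inl := by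
  refine TopCat.Presheaf.stalk_hom_ext _ fun U hU => RingCat.hom_ext (RingHom.ext fun s => ?_)
  exact (congrArg p.eval (p.stalkFst_germ U hU s)).trans (eval_germ p _ _ _)

theorem stalkSnd_eval (p : FibPt f g) : p.stalkSnd ≫ p.eval = p.inr := by
  refine TopCat.Presheaf.stalk_hom_ext _ fun U hU => RingCat.hom_ext (RingHom.ext fun s => ?_)
  exact (congrArg p.eval (p.stalkSnd_germ U hU s)).trans (eval_germ p _ _ _)

theorem stalk_condition_germ (p : FibPt f g) (W : Opens Y.toSheafedSpace) (hx : pt f p.x ∈ W)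
    (hz : pt g p.z ∈ W) (s : Y.presheaf.obj (op W)) :
    p.stalkFst (stalkMap f p.x (germ Y.toSheafedSpace W _ hx s)) =
      p.stalkSnd (stalkMap g p.z (germ Y.toSheafedSpace W _ hz s)) := by
  have e1 := RingedSp.stalkMap_germ f.toRingedSpaceHom W p.x hx s
  have e2 := RingedSp.stalkMap_germ g.toRingedSpaceHom W p.z hz s
  refine (congrArg p.stalkFst e1).trans (Eq.trans ?_ (congrArg p.stalkSnd e2).symm)
  refine (p.stalkFst_germ _ hx _).trans (Eq.trans ?_ (p.stalkSnd_germ _ hz _).symm)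
  -- The preimages of `W` through `X` and through `Z` have the same points because `f(x) = g(z)` at
  -- each point; the two sections are then compared value by value.
  refine TopCat.Presheaf.germ_ext (fib f g).presheaf
    ((Opens.map (fibFst f g).hom.base).obj ((Opens.map f.toRingedSpaceHom.hom.base).obj W)) hx
    (𝟙 _) (homOfLE fun q hq => (congrArg (· ∈ W) q.h).mp hq) ?_
  refine Subtype.ext (funext fun q => ?_)
  have hqx : pt f q.1.x ∈ W := q.2
  have hqz : pt g q.1.z ∈ W := (congrArg (· ∈ W) q.1.h).mp hqx
  have e3 := RingedSp.stalkMap_germ f.toRingedSpaceHom W q.1.x hqx s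
  have e4 := RingedSp.stalkMap_germ g.toRingedSpaceHom W q.1.z hqz s
  exact (congrArg q.1.inl e3).symm.trans ((q.1.condition_germ W hqx hqz s).trans
    (congrArg q.1.inr e4))

theorem stalk_condition (p : FibPt f g) :
    stalkMap f p.x ≫ p.stalkFst = stalkMapOfEq f g p.h ≫ p.stalkSnd := by
  refine TopCat.Presheaf.stalk_hom_ext _ fun U hU => RingCat.hom_ext (RingHom.ext fun s => ?_)
  have hz : pt g p.z ∈ U := (congrArg (· ∈ U) p.h).mp hU
  exact (p.stalk_condition_germ U hU hz s).trans
    (congrArg p.stalkSnd (stalkMapOfEq_germ f g p.h U hU hz s).symm)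

/-- The homomorphism from a chart to a stalk. -/
noncomputable def evStalk (p : FibPt f g) (U : Opens X.toSheafedSpace)
    (V : Opens Z.toSheafedSpace) (hx : p.x ∈ U) (hz : p.z ∈ V) :
    chart X Z U V ⟶ (fib f g).presheaf.stalk p :=
  Limits.coprod.desc (germ X.toSheafedSpace U p.x hx ≫ p.stalkFst)
    (germ Z.toSheafedSpace V p.z hz ≫ p.stalkSnd)

theorem fracSection_germ (p : FibPt f g) (W : Opens (fib f g)) {U : Opens X.toSheafedSpace}
    {V : Opens Z.toSheafedSpace} {n : ℕ} (a : (fracLevel (chart X Z U V) n).idx)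
    (hW : ∀ p : W, ∃ hx hz h, Extends (p.1.ev U V hx hz) n a h) (hp : p ∈ W) (hx : p.x ∈ U)
    (hz : p.z ∈ V) :
    fracι _ n a ≫ fracSection W a hW ≫ germ (fib f g) W p hp = p.evStalk U V hx hz := by
  refine Limits.coprod.hom_ext ?_ ?_
  · rw [evStalk, Limits.coprod.inl_desc]
    refine RingCat.hom_ext (RingHom.ext fun s => ?_)
    refine Eq.trans ?_ (p.stalkFst_germ U hx s).symm
    refine TopCat.Presheaf.germ_ext (fib f g).presheaf W hp (𝟙 _)
      (homOfLE fun q hq => (hW ⟨q, hq⟩).choose) ?_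
    refine Subtype.ext (funext fun q => ?_)
    obtain ⟨hx, hz, h, e⟩ := hW q
    refine (fracSection_val W a hW _ q e).trans ?_
    have := (congrArg (fun k => Limits.coprod.inl ≫ k) e.fracι_comp).trans
      (FibPt.inl_ev q.1 U V hx hz)
    exact hom_congr this s
  · rw [evStalk, Limits.coprod.inr_desc]
    refine RingCat.hom_ext (RingHom.ext fun s => ?_)
    refine Eq.trans ?_ (p.stalkSnd_germ V hz s).symm
    refine TopCat.Presheaf.germ_ext (fib f g).presheaf W hp (𝟙 _)
      (homOfLE fun q hq => (hW ⟨q, hq⟩).choose_spec.choose) ?_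
    refine Subtype.ext (funext fun q => ?_)
    obtain ⟨hx, hz, h, e⟩ := hW q
    refine (fracSection_val W a hW _ q e).trans ?_
    have := (congrArg (fun k => Limits.coprod.inr ≫ k) e.fracι_comp).trans
      (FibPt.inr_ev q.1 U V hx hz)
    exact hom_congr this s

/-- As for `F(A)`: the pushout of stalks maps to the stalk at `p`, and evaluation is local, so this
map has system `p.sys` and factors through `p.loc`. The factorization inverts evaluation since germs
come from fractions of charts. -/
instance isIso_eval (p : FibPt f g) : IsIso p.eval := by
  have hn := p.nontrivial_stalk
  let κ : stalkPushout f g p.h ⟶ (fib f g).presheaf.stalk p :=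
    Limits.pushout.desc p.stalkFst p.stalkSnd p.stalk_condition
  have hκ : κ ≫ p.eval = p.sys.toLoc := by
    refine Limits.pushout.hom_ext ?_ ?_
    · refine (Category.assoc _ _ _).symm.trans ?_
      rw [Limits.pushout.inl_desc, stalkFst_eval]; rfl
    · refine (Category.assoc _ _ _).symm.trans ?_
      rw [Limits.pushout.inr_desc, stalkSnd_eval]; rfl
  have hs : FullSpec.ofHom κ hn = p.sys := by
    rw [← FullSpec.ofHom_comp_local κ p.eval hn p.nontrivial_loc p.isLocalHom_eval]
    refine Eq.trans ?_ (FullSpec.ofHom_toLoc p.sys)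
    congr 1
  obtain ⟨ψ, hψ, -⟩ := FullSpec.exists_descOf p.sys κ hn hs
  have h1 : p.inl ≫ ψ = p.stalkFst :=
    (Category.assoc _ _ _).trans ((congrArg (fun k => Limits.pushout.inl _ _ ≫ k) hψ).trans
      (Limits.pushout.inl_desc _ _ _))
  have h2 : p.inr ≫ ψ = p.stalkSnd :=
    (Category.assoc _ _ _).trans ((congrArg (fun k => Limits.pushout.inr _ _ ≫ k) hψ).trans
      (Limits.pushout.inr_desc _ _ _))
  refine ⟨ψ, ?_, ?_⟩
  · refine RingCat.hom_ext (RingHom.ext fun z => ?_)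
    obtain ⟨W, hW, t, rfl⟩ := TopCat.Presheaf.exists_germ_eq (fib f g).presheaf z
    obtain ⟨D, hD, -, U, V, n, a, b, hDa, e⟩ := germ_eq_of_fraction W t p hW
    have e' := e p hD hW
    obtain ⟨hx, hz, -⟩ := hDa ⟨p, hD⟩
    have key : fracSection D a hDa ≫ germ (fib f g) D p hD ≫ p.eval ≫ ψ =
        fracSection D a hDa ≫ germ (fib f g) D p hD := by
      refine frac_hom_ext ?_
      have e1 := fracSection_germ p D a hDa hD hx hz
      have e2 := congrArg (fun k => k ≫ p.eval ≫ ψ) e1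
      simp only [Category.assoc] at e2
      rw [e1, e2, evStalk, Limits.coprod.desc_comp, Category.assoc, Category.assoc,
        ← Category.assoc p.stalkFst, ← Category.assoc p.stalkSnd, stalkFst_eval, stalkSnd_eval,
        h1, h2]
    exact (congrArg (p.eval ≫ ψ) e').trans ((hom_congr key b).trans e'.symm)
  · refine FibPt.loc_hom_ext ?_ ?_
    · rw [← Category.assoc, h1, stalkFst_eval, Category.comp_id]
    · rw [← Category.assoc, h2, stalkSnd_eval, Category.comp_id]

variable {B : RingCat.{u}}

theorem inl_inv_eval (p : FibPt f g) : p.inl ≫ inv p.eval = p.stalkFst := by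
  rw [IsIso.comp_inv_eq, stalkFst_eval]

theorem inr_inv_eval (p : FibPt f g) : p.inr ≫ inv p.eval = p.stalkSnd := by
  rw [IsIso.comp_inv_eq, stalkSnd_eval]

theorem stalk_hom_ext {p : FibPt f g} {k k' : (fib f g).presheaf.stalk p ⟶ B}
    (h1 : p.stalkFst ≫ k = p.stalkFst ≫ k') (h2 : p.stalkSnd ≫ k = p.stalkSnd ≫ k') : k = k' := by
  rw [← cancel_epi (inv p.eval)]
  refine FibPt.loc_hom_ext ?_ ?_
  · rw [← Category.assoc, ← Category.assoc, inl_inv_eval, h1]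
  · rw [← Category.assoc, ← Category.assoc, inr_inv_eval, h2]

/-- The agreement is stated on germs of sections, which makes sense before the underlying points of
`p` and `q` are identified. -/
theorem eq_of_loc_local {p q : FibPt f g} (hB : Nontrivial B) (k : p.loc ⟶ B) (k' : q.loc ⟶ B)
    (hk : IsLocalHom k.hom) (hk' : IsLocalHom k'.hom) (hx : p.x = q.x) (hz : p.z = q.z)
    (h1 : ∀ (U : Opens X.toSheafedSpace) (s : X.presheaf.obj (op U)) (hp : p.x ∈ U) (hq : q.x ∈ U),
      k (p.inl (germ _ U p.x hp s)) = k' (q.inl (germ _ U q.x hq s)))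
    (h2 : ∀ (U : Opens Z.toSheafedSpace) (s : Z.presheaf.obj (op U)) (hp : p.z ∈ U) (hq : q.z ∈ U),
      k (p.inr (germ _ U p.z hp s)) = k' (q.inr (germ _ U q.z hq s))) : p = q := by
  obtain ⟨x, z, h, S, hl, hr⟩ := p
  obtain ⟨x', z', h', S', hl', hr'⟩ := q
  obtain rfl : x = x' := hx
  obtain rfl : z = z' := hz
  have : S = S' := by
    refine FullSpec.eq_of_local S S' k k' hk hk' hB (Limits.pushout.hom_ext ?_ ?_)
    · refine TopCat.Presheaf.stalk_hom_ext _ fun U hU => RingCat.hom_ext (RingHom.ext fun s => ?_)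
      exact h1 U s hU hU
    · refine TopCat.Presheaf.stalk_hom_ext _ fun U hU => RingCat.hom_ext (RingHom.ext fun s => ?_)
      exact h2 U s hU hU
  subst this
  rfl

theorem eq_of_stalk_local {p q : FibPt f g} (hB : Nontrivial B)
    (k : (fib f g).presheaf.stalk p ⟶ B) (k' : (fib f g).presheaf.stalk q ⟶ B)
    (hk : IsLocalHom k.hom) (hk' : IsLocalHom k'.hom) (hx : p.x = q.x) (hz : p.z = q.z)
    (h1 : ∀ (U : Opens X.toSheafedSpace) (s : X.presheaf.obj (op U)) (hp : p.x ∈ U) (hq : q.x ∈ U),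
      k (p.stalkFst (germ _ U p.x hp s)) = k' (q.stalkFst (germ _ U q.x hq s)))
    (h2 : ∀ (U : Opens Z.toSheafedSpace) (s : Z.presheaf.obj (op U)) (hp : p.z ∈ U) (hq : q.z ∈ U),
      k (p.stalkSnd (germ _ U p.z hp s)) = k' (q.stalkSnd (germ _ U q.z hq s))) : p = q := by
  have hi : ∀ r : FibPt f g, IsLocalHom (inv r.eval).hom := fun r => isLocalHom_iso _
  refine eq_of_loc_local hB (inv p.eval ≫ k) (inv q.eval ≫ k') (isLocalHom_comp _ _ (hi p) hk)
    (isLocalHom_comp _ _ (hi q) hk') hx hz (fun U s hp hq => ?_) (fun U s hp hq => ?_)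
  · exact (congrArg k (hom_congr p.inl_inv_eval _)).trans ((h1 U s hp hq).trans
      (congrArg k' (hom_congr q.inl_inv_eval _)).symm)
  · exact (congrArg k (hom_congr p.inr_inv_eval _)).trans ((h2 U s hp hq).trans
      (congrArg k' (hom_congr q.inr_inv_eval _)).symm)

theorem map_germ_congr {p q : FibPt f g} (e : p = q)
    (k : (fib f g).presheaf.stalk p ⟶ B) (k' : (fib f g).presheaf.stalk q ⟶ B)
    (h1 : ∀ (U : Opens X.toSheafedSpace) (s : X.presheaf.obj (op U)) (hp : p.x ∈ U) (hq : q.x ∈ U),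
      k (p.stalkFst (germ _ U p.x hp s)) = k' (q.stalkFst (germ _ U q.x hq s)))
    (h2 : ∀ (U : Opens Z.toSheafedSpace) (s : Z.presheaf.obj (op U)) (hp : p.z ∈ U) (hq : q.z ∈ U),
      k (p.stalkSnd (germ _ U p.z hp s)) = k' (q.stalkSnd (germ _ U q.z hq s)))
    (W : Opens (fib f g)) (hp : p ∈ W) (hq : q ∈ W) (t : (fib f g).presheaf.obj (op W)) :
    k (germ (fib f g) W p hp t) = k' (germ (fib f g) W q hq t) := by
  subst e
  have : k = k' := by
    refine stalk_hom_ext ?_ ?_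
    · refine TopCat.Presheaf.stalk_hom_ext _ fun U hU => RingCat.hom_ext (RingHom.ext fun s => ?_)
      exact h1 U s hU hU
    · refine TopCat.Presheaf.stalk_hom_ext _ fun U hU => RingCat.hom_ext (RingHom.ext fun s => ?_)
      exact h2 U s hU hU
  rw [this]

end FibPt

end FiberProduct

end LocSpace

/-! ### Universal property of the fiber product -/

namespace LocSpace

open RingedSp FibPt

section FiberProduct

variable {X Y Z : LocSpace.{u}} (f : X ⟶ Y) (g : Z ⟶ Y)

/-- The fiber product as a ringed space with nonzero stalks. -/
noncomputable abbrev fibLoc : LocSpace.{u} where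
  toSheafedSpace := fib f g
  nontrivial_stalk p := FibPt.nontrivial_stalk (f := f) (g := g) p

theorem isLocalHom_stalkFst (p : FibPt f g) : IsLocalHom p.stalkFst.hom :=
  isLocalHom_of_comp p.stalkFst p.eval (by rw [stalkFst_eval]; exact p.local_inl)

theorem isLocalHom_stalkSnd (p : FibPt f g) : IsLocalHom p.stalkSnd.hom :=
  isLocalHom_of_comp p.stalkSnd p.eval (by rw [stalkSnd_eval]; exact p.local_inr)

/-- The first projection. -/
noncomputable def fst : fibLoc f g ⟶ X :=
  Hom.mk (fibFst f g) (fun p => isLocalHom_stalkFst f g p)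

/-- The second projection. -/
noncomputable def snd : fibLoc f g ⟶ Z :=
  Hom.mk (fibSnd f g) (fun p => isLocalHom_stalkSnd f g p)

theorem fib_condition : fst f g ≫ f = snd f g ≫ g := by
  refine hom_ext (RingedSp.hom_ext (fun p => FibPt.h (f := f) (g := g) p) fun W s p hx hz => ?_)
  refine (stalkMap_comp_apply _ _ p _).trans (Eq.trans ?_ (stalkMap_comp_apply _ _ p _).symm)
  exact FibPt.stalk_condition_germ (f := f) (g := g) p W hx hz s

variable {f g}

section Lift

variable {T : LocSpace.{u}} (a : T ⟶ X) (b : T ⟶ Z) (w : a ≫ f = b ≫ g)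

theorem lift_point (w : a ≫ f = b ≫ g) (t : T.toSheafedSpace) : pt f (pt a t) = pt g (pt b t) :=
  congrArg (fun k => pt k t) w

theorem lift_stalk_germ (w : a ≫ f = b ≫ g) (t : T.toSheafedSpace) (U : Opens Y.toSheafedSpace)
    (hx : pt f (pt a t) ∈ U) (hz : pt g (pt b t) ∈ U) (s : Y.presheaf.obj (op U)) :
    stalkMap a t (stalkMap f (pt a t) (germ Y.toSheafedSpace U _ hx s)) =
      stalkMap b t (stalkMap g (pt b t) (germ Y.toSheafedSpace U _ hz s)) :=
  (stalkMap_comp_apply a.toRingedSpaceHom f.toRingedSpaceHom t _).symm.trans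
    ((stalkMap_germ_congr w t U hx hz s).trans
      (stalkMap_comp_apply b.toRingedSpaceHom g.toRingedSpaceHom t _))

theorem lift_stalk (t : T.toSheafedSpace) : stalkMap f (pt a t) ≫ stalkMap a t =
    stalkMapOfEq f g (lift_point a b w t) ≫ stalkMap b t := by
  refine TopCat.Presheaf.stalk_hom_ext _ fun U hU => RingCat.hom_ext (RingHom.ext fun s => ?_)
  have hz : pt g (pt b t) ∈ U := (congrArg (· ∈ U) (lift_point a b w t)).mp hU
  exact (lift_stalk_germ a b w t U hU hz s).trans
    (congrArg (stalkMap b t) (stalkMapOfEq_germ f g (lift_point a b w t) U hU hz s).symm)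

/-- The homomorphism from the pushout of the stalks induced by a cone. -/
noncomputable def liftStalk (t : T.toSheafedSpace) :
    stalkPushout f g (lift_point a b w t) ⟶ T.presheaf.stalk t :=
  Limits.pushout.desc (stalkMap a t) (stalkMap b t) (lift_stalk a b w t)

theorem inl_liftStalk (t : T.toSheafedSpace) :
    Limits.pushout.inl _ _ ≫ liftStalk a b w t = stalkMap a t := Limits.pushout.inl_desc _ _ _

theorem inr_liftStalk (t : T.toSheafedSpace) :
    Limits.pushout.inr _ _ ≫ liftStalk a b w t = stalkMap b t := Limits.pushout.inr_desc _ _ _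

/-- The local homomorphism from the localization at the system of `liftStalk`. -/
noncomputable def liftDesc (t : T.toSheafedSpace) :
    (FullSpec.ofHom (liftStalk a b w t) (T.nontrivial_stalk t)).loc ⟶ T.presheaf.stalk t :=
  FullSpec.desc (liftStalk a b w t) (T.nontrivial_stalk t)

theorem isLocalHom_liftDesc (t : T.toSheafedSpace) : IsLocalHom (liftDesc a b w t).hom :=
  FullSpec.isLocalHom_desc _ _

theorem inl_liftDesc (t : T.toSheafedSpace) :
    (Limits.pushout.inl _ _ ≫ (FullSpec.ofHom (liftStalk a b w t) (T.nontrivial_stalk t)).toLoc) ≫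
      liftDesc a b w t = stalkMap a t := by
  refine (Category.assoc _ _ _).trans (Eq.trans ?_ (inl_liftStalk a b w t))
  exact congrArg (fun k => Limits.pushout.inl _ _ ≫ k) (FullSpec.toLoc_desc _ _)

theorem inr_liftDesc (t : T.toSheafedSpace) :
    (Limits.pushout.inr _ _ ≫ (FullSpec.ofHom (liftStalk a b w t) (T.nontrivial_stalk t)).toLoc) ≫
      liftDesc a b w t = stalkMap b t := by
  refine (Category.assoc _ _ _).trans (Eq.trans ?_ (inr_liftStalk a b w t))
  exact congrArg (fun k => Limits.pushout.inr _ _ ≫ k) (FullSpec.toLoc_desc _ _)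

/-- The map of points into the fiber product induced by a cone. -/
noncomputable def liftPt (t : T.toSheafedSpace) : FibPt f g where
  x := pt a t
  z := pt b t
  h := lift_point a b w t
  sys := FullSpec.ofHom (liftStalk a b w t) (T.nontrivial_stalk t)
  local_inl := isLocalHom_of_comp _ (liftDesc a b w t) (by
    rw [inl_liftDesc]; exact a.isLocal t)
  local_inr := isLocalHom_of_comp _ (liftDesc a b w t) (by
    rw [inr_liftDesc]; exact b.isLocal t)

/-- The homomorphism from the ring attached to `liftPt`. -/
noncomputable def liftLoc (t : T.toSheafedSpace) : (liftPt a b w t).loc ⟶ T.presheaf.stalk t :=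
  liftDesc a b w t

theorem inl_liftLoc (t : T.toSheafedSpace) :
    (liftPt a b w t).inl ≫ liftLoc a b w t = stalkMap a t := inl_liftDesc a b w t

theorem inr_liftLoc (t : T.toSheafedSpace) :
    (liftPt a b w t).inr ≫ liftLoc a b w t = stalkMap b t := inr_liftDesc a b w t

/-- The homomorphism from a chart to the sections over the preimage. -/
noncomputable def liftChart (U : Opens X.toSheafedSpace) (V : Opens Z.toSheafedSpace) :
    chart X Z U V ⟶ T.presheaf.obj (op ((Opens.map a.toRingedSpaceHom.hom.base).obj U ⊓
      (Opens.map b.toRingedSpaceHom.hom.base).obj V)) :=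
  Limits.coprod.desc
    (a.toRingedSpaceHom.hom.c.app (op U) ≫ T.presheaf.map (Opens.infLELeft _ _).op)
    (b.toRingedSpaceHom.hom.c.app (op V) ≫ T.presheaf.map (Opens.infLERight _ _).op)

/-- Relates the chart over open sets to the stalkwise lift; this is what makes the lift continuous
and compatible with sections. -/
theorem liftChart_germ (U : Opens X.toSheafedSpace) (V : Opens Z.toSheafedSpace)
    (t : T.toSheafedSpace) (hx : pt a t ∈ U) (hz : pt b t ∈ V) :
    liftChart a b U V ≫ germ T.toSheafedSpace _ t ⟨hx, hz⟩ =
      (liftPt a b w t).ev U V hx hz ≫ liftLoc a b w t := by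
  have ht : t ∈ (Opens.map a.toRingedSpaceHom.hom.base).obj U ⊓
      (Opens.map b.toRingedSpaceHom.hom.base).obj V := ⟨hx, hz⟩
  refine Limits.coprod.hom_ext ?_ ?_
  · refine RingCat.hom_ext (RingHom.ext fun s => ?_)
    have e : Limits.coprod.inl ≫ liftChart a b U V = a.toRingedSpaceHom.hom.c.app (op U) ≫
      T.presheaf.map (Opens.infLELeft _ _).op := Limits.coprod.inl_desc _ _
    refine (congrArg (germ T.toSheafedSpace _ t ht) (hom_congr e s)).trans
      ((germ_res_apply (X := T.toSheafedSpace) (Opens.infLELeft _ _) t ht _).trans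
      ((RingedSp.stalkMap_germ a.toRingedSpaceHom U t hx s).symm.trans (Eq.symm ?_)))
    exact (congrArg (liftLoc a b w t) (hom_congr ((liftPt a b w t).inl_ev U V hx hz) s)).trans
      (hom_congr (inl_liftLoc a b w t) _)
  · refine RingCat.hom_ext (RingHom.ext fun s => ?_)
    have e : Limits.coprod.inr ≫ liftChart a b U V = b.toRingedSpaceHom.hom.c.app (op V) ≫
      T.presheaf.map (Opens.infLERight _ _).op := Limits.coprod.inr_desc _ _
    refine (congrArg (germ T.toSheafedSpace _ t ht) (hom_congr e s)).trans
      ((germ_res_apply (X := T.toSheafedSpace) (Opens.infLERight _ _) t ht _).trans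
      ((RingedSp.stalkMap_germ b.toRingedSpaceHom V t hz s).symm.trans (Eq.symm ?_)))
    exact (congrArg (liftLoc a b w t) (hom_congr ((liftPt a b w t).inr_ev U V hx hz) s)).trans
      (hom_congr (inr_liftLoc a b w t) _)

/-- The open set on which a fraction of a chart becomes defined. -/
theorem exists_lift_extends (U : Opens X.toSheafedSpace) (V : Opens Z.toSheafedSpace) {n : ℕ}
    (c : (fracLevel (chart X Z U V) n).idx) :
    ∃ (W : Opens T.toSheafedSpace)
      (ψ : (fracLevel (chart X Z U V) n).ring c ⟶ T.presheaf.obj (op W)),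
      (∀ t, t ∈ W ↔ liftPt a b w t ∈ FibPt.basicOpen f g U V c) ∧
      ∀ (t : T.toSheafedSpace) (ht : t ∈ W) {hx hz h},
        Extends ((liftPt a b w t).ev U V hx hz) n c h →
        ψ ≫ germ T.toSheafedSpace W t ht = h ≫ liftLoc a b w t := by
  obtain ⟨W, i, ψ, hψ, hW⟩ := exists_extends (X := T.toSheafedSpace) (liftChart a b U V) n c
  have key : ∀ (t : T.toSheafedSpace) (ht : t ∈ W),
      Extends ((liftPt a b w t).ev U V (i.le ht).1 (i.le ht).2 ≫ liftLoc a b w t) n c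
        (ψ ≫ germ T.toSheafedSpace W t ht) := fun t ht => by
    have e := hψ.comp (germ T.toSheafedSpace W t ht)
    rw [Category.assoc] at e
    have e' : T.presheaf.map i.op ≫ germ T.toSheafedSpace W t ht =
      germ T.toSheafedSpace _ t (i.le ht) := T.presheaf.germ_res i t ht
    rw [e', liftChart_germ a b w U V t (i.le ht).1 (i.le ht).2] at e
    exact e
  refine ⟨W, ψ, fun t => ⟨fun ht => ?_, ?_⟩, fun t ht hx hz h e => ?_⟩
  · exact ⟨(i.le ht).1, (i.le ht).2, (key t ht).descend _ (isLocalHom_liftDesc a b w t)⟩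
  · rintro ⟨hx, hz, h, e⟩
    refine hW t ⟨hx, hz⟩ ⟨h ≫ liftLoc a b w t, ?_⟩
    rw [liftChart_germ a b w U V t hx hz]
    exact e.comp _
  · exact (key t ht).unique (e.comp _)

theorem continuous_liftPt : Continuous (liftPt a b w) := by
  refine continuous_generateFrom_iff.2 ?_
  rintro _ ⟨U, V, n, c, rfl⟩
  obtain ⟨W, -, hW, -⟩ := exists_lift_extends a b w U V c
  exact (congrArg IsOpen (Set.ext hW)).mp W.2

/-- The continuous map into the fiber product induced by a cone. -/
noncomputable def liftBase : (T.toSheafedSpace : TopCat.{u}) ⟶ (fib f g : TopCat.{u}) :=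
  TopCat.ofHom ⟨liftPt a b w, continuous_liftPt a b w⟩

/-- The morphism into the fiber product induced by a cone. -/
noncomputable def liftHom : T.toSheafedSpace ⟶ fib f g :=
  homOfStalks (T := T.toSheafedSpace) (Q := fib f g) (liftBase a b w)
    (fun t => (liftPt a b w t).eval ≫ liftLoc a b w t) (by
      intro W s t ht
      obtain ⟨D, hD, -, U, V, n, c, d, hDa, e⟩ := germ_eq_of_fraction W s (liftPt a b w t) ht
      obtain ⟨E, ψ, hE, hψ⟩ := exists_lift_extends a b w U V c
      refine ⟨E ⊓ (Opens.map (liftBase a b w)).obj D, ⟨(hE t).2 (hDa ⟨_, hD⟩), hD⟩,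
        T.presheaf.map (Opens.infLELeft _ _).op (ψ d), fun y hy hU => ?_⟩
      obtain ⟨hx, hz, h, he⟩ := hDa ⟨liftPt a b w y, hy.2⟩
      refine (germ_res_apply (X := T.toSheafedSpace) (Opens.infLELeft _ _) y hy _).trans ?_
      refine (hom_congr (hψ y hy.1 he) d).trans (congrArg (liftLoc a b w y) ?_)
      refine Eq.trans ?_ (congrArg (liftPt a b w y).eval (e (liftPt a b w y) hy.2 hU)).symm
      exact (fracSection_val D c hDa d ⟨liftPt a b w y, hy.2⟩ he).symm.trans
        (eval_germ (liftPt a b w y) D hy.2 _).symm)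

theorem liftHom_stalkMap (t : T.toSheafedSpace) : (liftHom a b w).hom.stalkMap t =
    (liftPt a b w t).eval ≫ liftLoc a b w t := homOfStalks_stalkMap _ _ _ t

/-- The morphism into the fiber product induced by a cone. -/
noncomputable def lift : T ⟶ fibLoc f g where
  toRingedSpaceHom := liftHom a b w
  isLocal t := by
    refine (congrArg (fun k => IsLocalHom (RingCat.Hom.hom k)) (liftHom_stalkMap a b w t)).mpr ?_
    exact isLocalHom_comp _ _ (isLocalHom_eval _) (isLocalHom_liftDesc a b w t)

theorem lift_fst : lift a b w ≫ fst f g = a := by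
  refine hom_ext (RingedSp.hom_ext (fun t => rfl) fun W s t hx hz => ?_)
  refine (stalkMap_comp_apply _ _ t _).trans ?_
  refine (hom_congr (liftHom_stalkMap a b w t) _).trans ?_
  exact (congrArg (liftLoc a b w t) (hom_congr (stalkFst_eval (liftPt a b w t)) _)).trans
    (hom_congr (inl_liftLoc a b w t) _)

theorem lift_snd : lift a b w ≫ snd f g = b := by
  refine hom_ext (RingedSp.hom_ext (fun t => rfl) fun W s t hx hz => ?_)
  refine (stalkMap_comp_apply _ _ t _).trans ?_
  refine (hom_congr (liftHom_stalkMap a b w t) _).trans ?_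
  exact (congrArg (liftLoc a b w t) (hom_congr (stalkSnd_eval (liftPt a b w t)) _)).trans
    (hom_congr (inr_liftLoc a b w t) _)

end Lift

/-- The projections fix `x`, `z` and the homomorphism from the pushout of stalks; as the stalk
homomorphisms are local, this fixes the system, hence the point, and then the germs. -/
theorem fib_hom_ext {T : LocSpace.{u}} {m m' : T ⟶ fibLoc f g} (h1 : m ≫ fst f g = m' ≫ fst f g)
    (h2 : m ≫ snd f g = m' ≫ snd f g) : m = m' := by
  have k1 : ∀ (t : T.toSheafedSpace) (U : Opens X.toSheafedSpace) (s : X.presheaf.obj (op U))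
      (hp : FibPt.x (f := f) (g := g) (pt m t) ∈ U) (hq : FibPt.x (f := f) (g := g) (pt m' t) ∈ U),
      stalkMap m t (FibPt.stalkFst (f := f) (g := g) (pt m t) (germ _ U _ hp s)) =
      stalkMap m' t (FibPt.stalkFst (f := f) (g := g) (pt m' t) (germ _ U _ hq s)) :=
    fun t U s hp hq => (stalkMap_comp_apply _ _ t _).symm.trans
      ((stalkMap_germ_congr h1 t U hp hq s).trans (stalkMap_comp_apply _ _ t _))
  have k2 : ∀ (t : T.toSheafedSpace) (U : Opens Z.toSheafedSpace) (s : Z.presheaf.obj (op U))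
      (hp : FibPt.z (f := f) (g := g) (pt m t) ∈ U) (hq : FibPt.z (f := f) (g := g) (pt m' t) ∈ U),
      stalkMap m t (FibPt.stalkSnd (f := f) (g := g) (pt m t) (germ _ U _ hp s)) =
      stalkMap m' t (FibPt.stalkSnd (f := f) (g := g) (pt m' t) (germ _ U _ hq s)) :=
    fun t U s hp hq => (stalkMap_comp_apply _ _ t _).symm.trans
      ((stalkMap_germ_congr h2 t U hp hq s).trans (stalkMap_comp_apply _ _ t _))
  have hb : ∀ t : T.toSheafedSpace, pt m t = pt m' t := fun t =>
    eq_of_stalk_local (f := f) (g := g) (T.nontrivial_stalk t) (stalkMap m t) (stalkMap m' t)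
      (m.isLocal t) (m'.isLocal t) (congrArg (fun k => pt k t) h1) (congrArg (fun k => pt k t) h2)
      (k1 t) (k2 t)
  exact hom_ext (RingedSp.hom_ext hb fun W s t hp hq =>
    FibPt.map_germ_congr (f := f) (g := g) (hb t) (stalkMap m t) (stalkMap m' t) (k1 t) (k2 t)
      W hp hq s)

variable (f g) in
/-- Fiber products of ringed spaces with nonzero stalks. -/
theorem isPullback_fib : IsPullback (fst f g) (snd f g) f g :=
  ⟨⟨fib_condition f g⟩, ⟨Limits.PullbackCone.IsLimit.mk _
    (fun s => lift s.fst s.snd s.condition) (fun _ => lift_fst _ _ _) (fun _ => lift_snd _ _ _)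
    (fun _ _ h1 h2 => fib_hom_ext (h1.trans (lift_fst _ _ _).symm)
      (h2.trans (lift_snd _ _ _).symm))⟩⟩

end FiberProduct

end LocSpace

/-! ### Fiber products of F-schemes -/

namespace LocSpace

/-- Fiber products are compatible with open immersions. -/
theorem exists_isPullback_restrict {X Y Z P X' Y' Z' : LocSpace.{u}} {f : X ⟶ Y} {g : Z ⟶ Y}
    {p : P ⟶ X} {q : P ⟶ Z} (hP : IsPullback p q f g) {iX : X' ⟶ X} {iY : Y' ⟶ Y} {iZ : Z' ⟶ Z}
    (hX : IsOpenImm iX) (hY : IsOpenImm iY) (hZ : IsOpenImm iZ) {f' : X' ⟶ Y'} {g' : Z' ⟶ Y'}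
    (hf : f' ≫ iY = iX ≫ f) (hg : g' ≫ iY = iZ ≫ g) :
    ∃ (P' : LocSpace.{u}) (j : P' ⟶ P) (p' : P' ⟶ X') (q' : P' ⟶ Z'), IsOpenImm j ∧
      Set.range (pt j) = {x | pt p x ∈ Set.range (pt iX) ∧ pt q x ∈ Set.range (pt iZ)} ∧
      IsPullback p' q' f' g' := by
  let O : Opens P.toSheafedSpace :=
    ⟨{x | pt p x ∈ Set.range (pt iX) ∧ pt q x ∈ Set.range (pt iZ)},
      (hX.isOpen_range.preimage p.toRingedSpaceHom.hom.base.hom.continuous).inter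
        (hZ.isOpen_range.preimage q.toRingedSpaceHom.hom.base.hom.continuous)⟩
  let j := P.restrictι O
  have hj : IsOpenImm j := isOpenImm_restrictι P O
  have hr : Set.range (pt j) = O := range_restrictι P O
  have hjO : ∀ x, pt j x ∈ O := fun x => hr.le ⟨x, rfl⟩
  have := hX.mono
  have := hY.mono
  have := hZ.mono
  have := hj.mono
  obtain ⟨p', hp'⟩ := hX.exists_lift (j ≫ p) (by rintro _ ⟨x, rfl⟩; exact (hjO x).1)
  obtain ⟨q', hq'⟩ := hZ.exists_lift (j ≫ q) (by rintro _ ⟨x, rfl⟩; exact (hjO x).2)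
  -- A cone over the small diagram is one over the large diagram; its lift to `P` has projections in
  -- `X'` and `Z'`, so it lands in `O`.
  have key : ∀ s : Limits.PullbackCone f' g', ∃ l : s.pt ⟶ P.restrict O,
      l ≫ j ≫ p = s.fst ≫ iX ∧ l ≫ j ≫ q = s.snd ≫ iZ := fun s => by
    have e : (s.fst ≫ iX) ≫ f = (s.snd ≫ iZ) ≫ g := by
      rw [Category.assoc, Category.assoc, ← hf, ← hg, ← Category.assoc, ← Category.assoc,
        s.condition]
    obtain ⟨l, hl⟩ := hj.exists_lift (hP.lift _ _ e) (by
      rw [hr]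
      rintro _ ⟨t, rfl⟩
      exact ⟨⟨pt s.fst t, (congrArg (fun k => pt k t) (hP.lift_fst _ _ e)).symm⟩,
        ⟨pt s.snd t, (congrArg (fun k => pt k t) (hP.lift_snd _ _ e)).symm⟩⟩)
    exact ⟨l, by rw [← Category.assoc, hl, hP.lift_fst], by rw [← Category.assoc, hl, hP.lift_snd]⟩
  choose l hl1 hl2 using key
  refine ⟨_, j, p', q', hj, hr, ⟨⟨?_⟩, ⟨Limits.PullbackCone.IsLimit.mk _ l ?_ ?_ ?_⟩⟩⟩
  · rw [← cancel_mono iY, Category.assoc, Category.assoc, hf, hg, ← Category.assoc,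
      ← Category.assoc, hp', hq', Category.assoc, Category.assoc, hP.w]
  · intro s
    rw [← cancel_mono iX, Category.assoc, hp', hl1]
  · intro s
    rw [← cancel_mono iZ, Category.assoc, hq', hl2]
  · intro s m h1 h2
    rw [← cancel_mono j]
    refine hP.hom_ext ?_ ?_
    · rw [Category.assoc, Category.assoc, hl1, ← hp', ← Category.assoc, h1]
    · rw [Category.assoc, Category.assoc, hl2, ← hq', ← Category.assoc, h2]

/-- A fiber product of F-schemes is an F-scheme. -/
theorem IsFScheme.of_isPullback {X Y Z P : LocSpace.{u}} (hX : X.IsFScheme) (hY : Y.IsFScheme)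
    (hZ : Z.IsFScheme) {f : X ⟶ Y} {g : Z ⟶ Y} {p : P ⟶ X} {q : P ⟶ Z}
    (hP : IsPullback p q f g) : P.IsFScheme := by
  intro x
  obtain ⟨R, iY, hiY, hy⟩ := hY (pt f (pt p x))
  have hy' : pt g (pt q x) ∈ Set.range (pt iY) :=
    (congrArg (fun k => pt k x ∈ Set.range (pt iY)) hP.w).mp hy
  obtain ⟨A, iX, hiX, hx, hxr⟩ := hX.exists_affine
    (hiY.isOpen_range.preimage f.toRingedSpaceHom.hom.base.hom.continuous) hy
  obtain ⟨B, iZ, hiZ, hz, hzr⟩ := hZ.exists_affine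
    (hiY.isOpen_range.preimage g.toRingedSpaceHom.hom.base.hom.continuous) hy'
  obtain ⟨f', hf'⟩ := hiY.exists_lift (iX ≫ f) (by
    rintro _ ⟨t, rfl⟩; exact hxr ⟨t, rfl⟩)
  obtain ⟨g', hg'⟩ := hiY.exists_lift (iZ ≫ g) (by
    rintro _ ⟨t, rfl⟩; exact hzr ⟨t, rfl⟩)
  obtain ⟨α, rfl, -⟩ := FullSpec.existsUnique_locSpaceMap f'
  obtain ⟨β, rfl, -⟩ := FullSpec.existsUnique_locSpaceMap g'
  obtain ⟨P', j, p', q', hj, hr, hP'⟩ := exists_isPullback_restrict hP hiX hiY hiZ hf' hg'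
  -- Two fiber products of the same affine diagram: the open piece `P'` of `P` and `F` of the
  -- pushout.
  let e := (FullSpec.isPullback_locSpaceMap α β).isoIsPullback _ _ hP'
  refine ⟨_, e.hom ≫ j, (IsOpenImm.of_iso e).comp hj, ?_⟩
  have hxj : x ∈ Set.range (pt j) := by rw [hr]; exact ⟨hx, hz⟩
  obtain ⟨x', rfl⟩ := hxj
  exact ⟨pt e.inv x', congrArg (fun k => pt j (pt k x')) e.inv_hom_id⟩

theorem nonempty_iso_of_range_eq {V W X : SheafedSpace RingCat.{u}} (f : V ⟶ X) (g : W ⟶ X)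
    (hf : SheafedSpace.IsOpenImmersion f) (hg : SheafedSpace.IsOpenImmersion g)
    (e : Set.range f.hom.base = Set.range g.hom.base) : Nonempty (V ≅ W) :=
  have : PresheafedSpace.IsOpenImmersion f.hom := hf
  have : PresheafedSpace.IsOpenImmersion g.hom := hg
  ⟨SheafedSpace.isoMk (PresheafedSpace.IsOpenImmersion.isoOfRangeEq f.hom g.hom e)⟩

/-- A ringed space which is covered by affine open subspaces, as an F-scheme. -/
def toFScheme (X : LocSpace.{u}) (hX : X.IsFScheme) : FScheme.{u} where
  toSheafedSpace := X.toSheafedSpace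
  local_affine x := by
    obtain ⟨A, j, hj, hx⟩ := hX x
    let U : OpenNhds x := ⟨⟨Set.range (pt j), hj.isOpen_range⟩, hx⟩
    exact ⟨U, A, nonempty_iso_of_range_eq (X.toSheafedSpace.ofRestrict U.isOpenEmbedding)
      j.toRingedSpaceHom inferInstance hj Subtype.range_val⟩

end LocSpace

/-! ### Transfer from `LocSpace` to F-schemes -/

namespace FScheme

open LocSpace

theorem exists_openImmersion (X : FScheme.{u}) (x : X.toSheafedSpace) :
    ∃ (A : RingCat.{u}) (j : FullSpec.ringedSpace A ⟶ X.toSheafedSpace)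
      (_ : SheafedSpace.IsOpenImmersion j), x ∈ Set.range j.hom.base := by
  obtain ⟨U, A, ⟨e⟩⟩ := X.local_affine x
  refine ⟨A, e.inv ≫ X.toSheafedSpace.ofRestrict U.isOpenEmbedding, inferInstance,
    e.hom.hom.base ⟨x, U.2⟩, ?_⟩
  have h : e.inv.hom.base (e.hom.hom.base ⟨x, U.2⟩) = ⟨x, U.2⟩ :=
    congrArg (fun k => k.hom.base ⟨x, U.2⟩) e.hom_inv_id
  exact congrArg Subtype.val h

/-- An F-scheme as a ringed space with nonzero stalks. -/
def toLocSpace (X : FScheme.{u}) : LocSpace.{u} where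
  toSheafedSpace := X.toSheafedSpace
  nontrivial_stalk x := by
    obtain ⟨A, j, hj, s, rfl⟩ := X.exists_openImmersion x
    have := FullSpec.nontrivial_stalk s
    exact (j.hom.stalkMap s).hom.domain_nontrivial

/-- Affine charts are given only as isomorphisms of ringed spaces, but open immersions are
isomorphisms on stalks and so automatically local. -/
theorem isFScheme_toLocSpace (X : FScheme.{u}) : X.toLocSpace.IsFScheme := by
  intro x
  obtain ⟨A, j, hj, hx⟩ := X.exists_openImmersion x
  exact ⟨A, LocSpace.Hom.mk j (fun s =>
    have := SheafedSpace.IsOpenImmersion.stalk_iso j s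
    isLocalHom_iso (j.hom.stalkMap s)), hj, hx⟩

/-- F-schemes as a full subcategory of the ringed spaces with nonzero stalks. -/
def forgetToLocSpace : FScheme.{u} ⥤ LocSpace.{u} where
  obj := toLocSpace
  map f := LocSpace.Hom.mk f.toRingedSpaceHom f.isLocal

/-- The functor to ringed spaces with nonzero stalks is fully faithful. -/
def fullyFaithfulForgetToLocSpace : forgetToLocSpace.{u}.FullyFaithful where
  preimage f := Hom.mk f.toRingedSpaceHom f.isLocal

instance : forgetToLocSpace.{u}.Full := fullyFaithfulForgetToLocSpace.full

instance : forgetToLocSpace.{u}.Faithful := fullyFaithfulForgetToLocSpace.faithful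

/-- A fully faithful functor reflects pullbacks. -/
theorem isPullback_of_forget {P X Y Z : FScheme.{u}} {p : P ⟶ X} {q : P ⟶ Z} {f : X ⟶ Y}
    {g : Z ⟶ Y} (h : IsPullback (forgetToLocSpace.map p) (forgetToLocSpace.map q)
      (forgetToLocSpace.map f) (forgetToLocSpace.map g)) : IsPullback p q f g :=
  IsPullback.of_map forgetToLocSpace (forgetToLocSpace.map_injective (by
    rw [Functor.map_comp, Functor.map_comp]; exact h.w)) h

theorem exists_isPullback {X Y Z : FScheme.{u}} (f : X ⟶ Y) (g : Z ⟶ Y) :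
    ∃ (P : FScheme.{u}) (p : P ⟶ X) (q : P ⟶ Z), IsPullback p q f g := by
  have h := isPullback_fib (forgetToLocSpace.map f) (forgetToLocSpace.map g)
  have hP := LocSpace.IsFScheme.of_isPullback X.isFScheme_toLocSpace Y.isFScheme_toLocSpace
    Z.isFScheme_toLocSpace h
  exact ⟨LocSpace.toFScheme _ hP, Hom.mk (LocSpace.fst _ _).toRingedSpaceHom (LocSpace.fst _ _).isLocal,
    Hom.mk (LocSpace.snd _ _).toRingedSpaceHom (LocSpace.snd _ _).isLocal, isPullback_of_forget h⟩

theorem existsUnique_specMap {R A : RingCat.{u}} (f : spec A ⟶ spec R) :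
    ∃! α : R ⟶ A, specMap α = f := by
  obtain ⟨α, hα, hu⟩ := FullSpec.existsUnique_locSpaceMap (forgetToLocSpace.map f)
  exact ⟨α, forgetToLocSpace.map_injective hα, fun β hβ =>
    hu β (congrArg (fun k => forgetToLocSpace.map k) hβ)⟩

theorem isPullback_specMap {R A B : RingCat.{u}} (α : R ⟶ A) (β : R ⟶ B) :
    IsPullback (specMap (Limits.pushout.inl α β)) (specMap (Limits.pushout.inr α β))
      (specMap α) (specMap β) :=
  isPullback_of_forget (FullSpec.isPullback_locSpaceMap α β)

end FScheme

end FSchemes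

theorem mainTheorem8 :
    -- existence of fiber products
    (∀ (X Y Z : FSchemes.FScheme.{u}) (f : X ⟶ Y) (g : Z ⟶ Y),
      ∃ (P : FSchemes.FScheme.{u}) (p : P ⟶ X) (q : P ⟶ Z), IsPullback p q f g) ∧
    -- uniqueness, up to a unique isomorphism compatible with the projections
    (∀ (X Y Z : FSchemes.FScheme.{u}) (f : X ⟶ Y) (g : Z ⟶ Y)
      (P P' : FSchemes.FScheme.{u}) (p : P ⟶ X) (q : P ⟶ Z) (p' : P' ⟶ X) (q' : P' ⟶ Z),
      IsPullback p q f g → IsPullback p' q' f g →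
        ∃! e : P ≅ P', e.hom ≫ p' = p ∧ e.hom ≫ q' = q) ∧
    -- the affine case: all morphisms `F(A) → F(R)` come from unique homomorphisms `R → A`, and
    -- the fiber product is `F` of the coproduct `A *_R B` (the pushout in unital rings)
    (∀ (R A : RingCat.{u}) (f : FSchemes.FScheme.spec A ⟶ FSchemes.FScheme.spec R),
      ∃! α : R ⟶ A, FSchemes.FScheme.specMap α = f) ∧
    (∀ (R A B : RingCat.{u}) (α : R ⟶ A) (β : R ⟶ B),
      IsPullback
        (FSchemes.FScheme.specMap (Limits.pushout.inl α β))
        (FSchemes.FScheme.specMap (Limits.pushout.inr α β))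
        (FSchemes.FScheme.specMap α) (FSchemes.FScheme.specMap β)) := by
  refine ⟨fun X Y Z f g => FSchemes.FScheme.exists_isPullback f g, ?_,
    fun R A f => FSchemes.FScheme.existsUnique_specMap f,
    fun R A B α β => FSchemes.FScheme.isPullback_specMap α β⟩
  intro X Y Z f g P P' p q p' q' h h'
  refine ⟨h.isoIsPullback X Z h', ⟨h.isoIsPullback_hom_fst X Z h',
    h.isoIsPullback_hom_snd X Z h'⟩, fun e he => Iso.ext (h'.hom_ext ?_ ?_)⟩
  · rw [he.1, h.isoIsPullback_hom_fst X Z h']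
  · rw [he.2, h.isoIsPullback_hom_snd X Z h']
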